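/- **Theorem 6 (computable Tychonoff theorem).** Let $\Sigma$ be a finite alphabet containing two distinct symbols $0,1$, let $\Sigma^*$ be the set of finite words and $\Sigma^\omega$ the set of infinite sequences over $\Sigma$. Put $\iota(a_1\ldots a_n)=110a_10a_2\ldots 0a_n011$ and write $u\ll p$ if $\iota(u)$ is a subword of the word or sequence $p$; say that $p\in\Sigma^\omega$ *enumerates* $A\subseteq\Sigma^*$ if $A=\{u\mid u\ll p\}$. Use the tuplings $\langle u_1,\ldots,u_n\rangle=\iota(u_1)\ldots\iota(u_n)$ of words, $\langle p_1,\ldots,p_n\rangle=p_1(0)\ldots p_n(0)p_1(1)\ldots p_n(1)\ldots$ of finitely many sequences, and $\langle p_1,p_2,\ldots\rangle$ of infinitely many sequences, defined by $\langle p_1,p_2,\ldots\rangle\big(\tfrac{(i+j)(i+j+1)}2+j\big)=p_{i+1}(j)$ for $i,j\ge 0$. An *effective topological space* is $\mathbf X=(X,\tau,\beta,\nu)$ where $(X,\tau)$ is a $T_0$-space and $\nu$ is a partial surjection from $\Sigma^*$ onto a base $\beta$ of $\tau$. A sequence $\langle r,s\rangle$ is a *$\Delta$-name* of $\mathbf X$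 if $r$ enumerates the graph of the characteristic function of $\mathrm{dom}(\nu)$ (coded as the set of words $\langle u,1\rangle$ with $u\in\mathrm{dom}(\nu)$ and $\langle u,0\rangle$ with $u\notin\mathrm{dom}(\nu)$), and $s$ enumerates (the words $\langle u,v,w\rangle$ for $(u,v,w)$ in) a set $S\subseteq\mathrm{dom}(\nu)^3$ such that $\nu(u)\cap\nu(v)=\bigcup\{\nu(w)\mid (u,v,w)\in S\}$ for all $u,v\in\mathrm{dom}(\nu)$. Let $\mathcal T_c$ be the class of all pairs $(\mathbf X,K)$ with $\mathbf X$ an effective topological space and $K\subseteq X$ compact. A sequence $\langle r,s\rangle$ is a *$\kappa^\Delta$-name* of $(\mathbf X,K)$ if $r$ is a $\Delta$-name of $\mathbf X$ and $s$ enumerates the set of all words $w$ such that $v\in\mathrm{dom}(\nu)$ for all $v\ll w$ and $K\subseteq\bigcup\{\nu(v)\mid v\ll w\}$. Products of effective topological spaces: $\mathbf X_1\times\mathbf X_2$ is $X_1\times X_2$ with the product topology and the base notation $\nu\langle u_1,u_2\rangle=\nu_1(u_1)\times\nu_2(u_2)$ for $u_i\in\mathrm{dom}(\nu_i)$; $\mathbf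 X_1\times\cdots\times\mathbf X_n=(\cdots(\mathbf X_1\times\mathbf X_2)\times\cdots)\times\mathbf X_n$ (for $n=1$ it is $\mathbf X_1$); $\mathbf X_1\times\mathbf X_2\times\cdots$ is $\prod_{i\ge1}X_i$ with the product topology and the base notation $\nu\langle u_1,\ldots,u_m\rangle=\nu_1(u_1)\times\cdots\times\nu_m(u_m)\times X_{m+1}\times X_{m+2}\times\cdots$ for $m\ge1$, $u_i\in\mathrm{dom}(\nu_i)$. A function between classes with naming relations is *computable* if some partial function on $\Sigma^\omega$ computable by a Type-2 machine (one-way input, one-way output) maps every name of every argument to a name of its value. Then the following functions are computable. 1. $(\mathcal T_c)^2\to\mathcal T_c$, $\ ((\mathbf X_1,K_1),(\mathbf X_2,K_2))\mapsto(\mathbf X_1\times\mathbf X_2,\,K_1\times K_2)$, where the names of an argument are the sequences $\langle p_1,p_2\rangle$ with $p_i$ a $\kappa^\Delta$-name of $(\mathbf X_i,K_i)$, and values have their $\kappa^\Delta$-names. 2. $\biguplus_{n\ge1}(\mathcal T_c)^n\to\mathcal T_c$, $\ (n,(\mathbf X_1,K_1),\ldots,(\mathbf X_n,K_n))\mapsto(\mathbf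 X_1\times\cdots\times\mathbf X_n,\,K_1\times\cdots\times K_n)$, where the names of an argument are the sequences $1^n0\langle p_1,\ldots,p_n\rangle$ with $p_i$ a $\kappa^\Delta$-name of $(\mathbf X_i,K_i)$, and values have their $\kappa^\Delta$-names. 3. $(\mathcal T_c)^{\mathbb N}\to\mathcal T_c$, $\ ((\mathbf X_1,K_1),(\mathbf X_2,K_2),\ldots)\mapsto(\mathbf X_1\times\mathbf X_2\times\cdots,\,K_1\times K_2\times\cdots)$, where the names of an argument are the sequences $\langle p_1,p_2,\ldots\rangle$ with $p_i$ a $\kappa^\Delta$-name of $(\mathbf X_i,K_i)$, and values have their $\kappa^\Delta$-names. -/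

import Mathlib

/-! Type-2 computability on multi-represented classes, effective topological spaces,
their products, and the multi-representation of compact sets by finite base covers. -/

universe u v

namespace TTE

/-! ### Words, sequences, tupling -/

/-- A finite alphabet with two distinguished symbols `0 ≠ 1`; `k` is the number of further
symbols. -/
abbrev Sym (k : ℕ) : Type := Fin (k + 2)

/-- Finite words. -/
abbrev Word (k : ℕ) : Type := List (Sym k)

/-- Infinite sequences. -/
abbrev Seq (k : ℕ) : Type := ℕ → Sym k

variable {k : ℕ}

/-- The wrapping function `a₁a₂…aₙ ↦ 11 0a₁ 0a₂ … 0aₙ 011`. -/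
def iota (w : Word k) : Word k := [1, 1] ++ w.flatMap (fun a => [0, a]) ++ [0, 1, 1]

/-- `⟨u₁,…,uₙ⟩ = ι(u₁)…ι(uₙ)`. -/
def tuple (l : List (Word k)) : Word k := l.flatMap iota

/-- The prefix of length `n` of a sequence. -/
def pre (p : Seq k) (n : ℕ) : Word k := (List.range n).map p

/-- `u ≪ w` for words: `ι(u)` is a subword of `w`. -/
def InWord (u w : Word k) : Prop := iota u <:+: w

/-- `u ≪ p` for sequences: `ι(u)` is a subword of `p`. -/
def InSeq (u : Word k) (p : Seq k) : Prop := ∃ n, iota u <:+: pre p n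

/-- The sequence `p` is a list of exactly the words of `A`. -/
def Enumerates (p : Seq k) (A : Set (Word k)) : Prop := ∀ w, InSeq w p ↔ w ∈ A

/-- `⟨p₁,…,pₙ₊₁⟩ = p₁(0)p₂(0)…pₙ₊₁(0)p₁(1)…`. -/
def seqTuple {n : ℕ} (p : Fin (n + 1) → Seq k) : Seq k :=
  fun m => p (Fin.ofNat (n + 1) m) (m / (n + 1))

/-- `⟨p,q⟩ = p(0)q(0)p(1)q(1)…`. -/
def seqPair (p q : Seq k) : Seq k := seqTuple ![p, q]

/-- The Cantor pairing function. -/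
def cantorPair (i j : ℕ) : ℕ := (i + j) * (i + j + 1) / 2 + j

/-- `q = ⟨p₀,p₁,…⟩`, that is, `q⟨i,j⟩ = pᵢ(j)`. -/
def IsSeqTuple (q : Seq k) (p : ℕ → Seq k) : Prop := ∀ i j, q (cantorPair i j) = p i j

/-- The sequence `1ⁿ0p`. -/
def tag (n : ℕ) (p : Seq k) : Seq k :=
  fun m => if m < n then 1 else if m = n then 0 else p (m - (n + 1))

/-! ### Type-2 machines -/

/-- A Type-2 machine with an infinite one-way read-only input tape, a one-way write-only output
tape and a discrete work memory. In one step it looks at its memory and at the input symbol under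
the reading head; it updates the memory, advances the head or not, and appends at most one symbol
to the output. The transition function is computable. -/
structure Machine (k : ℕ) where
  Mem : Type
  [mem : Primcodable Mem]
  init : Mem
  step : Mem × Sym k → Mem × Bool × Option (Sym k)
  step_computable : Computable step

/-- Memory, position of the input head, output written so far. -/
structure Machine.Config (M : Machine k) where
  mem : M.Mem
  head : ℕ
  out : Word k

/-- One step on input `p`. -/
def Machine.next (M : Machine k) (p : Seq k) (c : M.Config) : M.Config :=
  let r := M.step (c.mem, p c.head)
  { mem := r.1
    head := if r.2.1 then c.head + 1 else c.head
    out := c.out ++ r.2.2.toList }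

/-- The configuration after `t` steps on input `p`. -/
def Machine.run (M : Machine k) (p : Seq k) : ℕ → M.Config
  | 0 => ⟨M.init, 0, []⟩
  | t + 1 => M.next p (M.run p t)

/-- On input `p`, working forever, the machine writes the infinite sequence `q`. -/
def Machine.Writes (M : Machine k) (p q : Seq k) : Prop :=
  ∀ n, ∃ t, pre q n <+: (M.run p t).out

/-- A partial function on sequences is computable if it is the function `f_M` of some machine `M`:
`f_M(p) = q` if `M` writes `q` on input `p`, and `f_M(p)` is undefined if the output is finite. -/
def ComputableSeqFun (g : Seq k →. Seq k) : Prop :=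
  ∃ M : Machine k, ∀ p q, q ∈ g p ↔ M.Writes p q

/-! ### Multi-representations -/

/-- A naming relation: `δ p x` means that `p` is a `δ`-name of `x`. An object may have many names,
and a name may belong to many objects. -/
def MultiRep (k : ℕ) (M : Type u) : Type u := Seq k → M → Prop

/-- `g` realizes `f` if it maps every name of `x` to a name of `f x`. -/
def Realizes {M : Type u} {M' : Type v} (γ : MultiRep k M) (γ' : MultiRep k M')
    (g : Seq k →. Seq k) (f : M → M') : Prop :=
  ∀ p x, γ p x → ∃ q ∈ g p, γ' q (f x)

/-- `f` is `(γ,γ')`-computable. -/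
def RepComputable {M : Type u} {M' : Type v} (γ : MultiRep k M) (γ' : MultiRep k M')
    (f : M → M') : Prop :=
  ∃ g : Seq k →. Seq k, ComputableSeqFun g ∧ Realizes γ γ' g f

/-- `[γ,δ]`. -/
def MultiRep.pair {M : Type u} {M' : Type v} (γ : MultiRep k M) (δ : MultiRep k M') :
    MultiRep k (M × M') :=
  fun q x => ∃ p₁ p₂, q = seqPair p₁ p₂ ∧ γ p₁ x.1 ∧ δ p₂ x.2

/-- `[δ]⁺` on the disjoint union of the powers `Mⁿ`, `n ≥ 1`: the names of an `n`-tuple are the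
sequences `1ⁿ0⟨p₁,…,pₙ⟩`. The element `⟨n, x⟩` is a tuple of length `n + 1`. -/
def MultiRep.plus {M : Type u} (δ : MultiRep k M) : MultiRep k (Σ n : ℕ, (Fin (n + 1) → M)) :=
  fun q x => ∃ p : Fin (x.1 + 1) → Seq k,
    q = tag (x.1 + 1) (seqTuple p) ∧ ∀ i, δ (p i) (x.2 i)

/-- `[δ]^ℕ`. -/
def MultiRep.seq {M : Type u} (δ : MultiRep k M) : MultiRep k (ℕ → M) :=
  fun q x => ∃ p : ℕ → Seq k, IsSeqTuple q p ∧ ∀ i, δ (p i) (x i)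

/-! ### Effective topological spaces -/

/-- An effective topological space `(X,τ,β,ν)`: a `T₀`-space with a partial map `ν` from words
onto a base `β`. The partial map is given by its domain `dom` and its values on it; outside of
`dom` the value is set to `∅`, so that `x ∈ ν w` implies `w ∈ dom`. -/
structure EffSpace (k : ℕ) where
  carrier : Type u
  [top : TopologicalSpace carrier]
  t0 : T0Space carrier
  dom : Set (Word k)
  nu : Word k → Set carrier
  nu_off : ∀ w, w ∉ dom → nu w = ∅
  isBase : TopologicalSpace.IsTopologicalBasis (nu '' dom)

instance : CoeSort (EffSpace.{u} k) (Type u) := ⟨EffSpace.carrier⟩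

instance (X : EffSpace.{u} k) : TopologicalSpace X := X.top

instance (X : EffSpace.{u} k) : T0Space X := X.t0

theorem EffSpace.mem_dom (X : EffSpace.{u} k) {w : Word k} {x : X} (h : x ∈ X.nu w) :
    w ∈ X.dom := by
  by_contra hw
  rw [X.nu_off w hw] at h
  exact h

theorem EffSpace.isOpen_nu (X : EffSpace.{u} k) (w : Word k) : IsOpen (X.nu w) := by
  by_cases hw : w ∈ X.dom
  · exact X.isBase.isOpen ⟨w, hw, rfl⟩
  · rw [X.nu_off w hw]; exact isOpen_empty

theorem EffSpace.exists_nu (X : EffSpace.{u} k) {x : X} {U : Set X} (hU : IsOpen U) (hx : x ∈ U) :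
    ∃ w ∈ X.dom, x ∈ X.nu w ∧ X.nu w ⊆ U := by
  obtain ⟨_, ⟨w, hw, rfl⟩, h⟩ := X.isBase.exists_subset_of_mem_open hx hU
  exact ⟨w, hw, h⟩

/-! ### Unique decoding of tuples of words -/

theorem iota_append_inj {u v s t : Word k} (h : iota u ++ s = iota v ++ t) : u = v ∧ s = t := by
  simp only [iota, List.append_assoc, List.cons_append, List.nil_append, List.cons.injEq,
    true_and] at h
  induction u generalizing v with
  | nil =>
    cases v with
    | nil => simpa using h
    | cons a v =>
      simp only [List.flatMap_nil, List.nil_append, List.flatMap_cons, List.cons_append,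
        List.cons.injEq, true_and] at h
      exfalso
      cases v <;> simp at h
  | cons a u ih =>
    cases v with
    | nil =>
      simp only [List.flatMap_nil, List.nil_append, List.flatMap_cons, List.cons_append,
        List.cons.injEq, true_and] at h
      exfalso
      cases u <;> simp at h
    | cons b v =>
      simp only [List.nil_append, List.flatMap_cons, List.cons_append,
        List.cons.injEq, true_and] at h
      obtain ⟨h1, h2⟩ := ih h.2
      exact ⟨by rw [h.1, h1], h2⟩

theorem tuple_injective : Function.Injective (tuple (k := k)) := by
  intro l
  induction l with
  | nil =>
    intro m h
    cases m with
    | nil => rfl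
    | cons b m => simp [tuple, iota] at h
  | cons a l ih =>
    intro m h
    cases m with
    | nil => simp [tuple, iota] at h
    | cons b m =>
      simp only [tuple, List.flatMap_cons] at h
      obtain ⟨h1, h2⟩ := iota_append_inj h
      rw [h1, ih h2]

/-! ### Products of effective topological spaces -/

/-- Base sets of the binary product: `ν⟨u₁,u₂⟩ = ν₁(u₁) × ν₂(u₂)`. -/
def EffSpace.prodNu (X Y : EffSpace.{u} k) (w : Word k) : Set (X × Y) :=
  {z | ∃ u₁ u₂, w = tuple [u₁, u₂] ∧ z ∈ X.nu u₁ ×ˢ Y.nu u₂}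

theorem EffSpace.prodNu_tuple (X Y : EffSpace.{u} k) (u₁ u₂ : Word k) :
    X.prodNu Y (tuple [u₁, u₂]) = X.nu u₁ ×ˢ Y.nu u₂ := by
  ext z
  constructor
  · rintro ⟨v₁, v₂, h, hz⟩
    have := tuple_injective h
    simp only [List.cons.injEq, and_true] at this
    rw [this.1, this.2]; exact hz
  · intro hz; exact ⟨u₁, u₂, rfl, hz⟩

/-- The binary product, with the product topology. -/
def EffSpace.prod (X Y : EffSpace.{u} k) : EffSpace.{u} k where
  carrier := X × Y
  t0 := inferInstance
  dom := {w | ∃ u₁ ∈ X.dom, ∃ u₂ ∈ Y.dom, w = tuple [u₁, u₂]}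
  nu := X.prodNu Y
  nu_off := by
    intro w hw
    rw [Set.eq_empty_iff_forall_notMem]
    rintro z ⟨u₁, u₂, h, hz⟩
    exact hw ⟨u₁, X.mem_dom hz.1, u₂, Y.mem_dom hz.2, h⟩
  isBase := by
    refine TopologicalSpace.isTopologicalBasis_of_isOpen_of_nhds ?_ ?_
    · rintro _ ⟨_, ⟨u₁, _, u₂, _, rfl⟩, rfl⟩
      rw [X.prodNu_tuple]
      exact (X.isOpen_nu u₁).prod (Y.isOpen_nu u₂)
    · rintro ⟨x, y⟩ U hz hU
      obtain ⟨V, W, hV, hW, hx, hy, hVW⟩ := isOpen_prod_iff.1 hU x y hz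
      obtain ⟨u₁, h₁, hx₁, hs₁⟩ := X.exists_nu hV hx
      obtain ⟨u₂, h₂, hx₂, hs₂⟩ := Y.exists_nu hW hy
      refine ⟨_, ⟨_, ⟨u₁, h₁, u₂, h₂, rfl⟩, rfl⟩, ?_, ?_⟩
      · rw [X.prodNu_tuple]; exact ⟨hx₁, hx₂⟩
      · rw [X.prodNu_tuple]; exact (Set.prod_mono hs₁ hs₂).trans hVW

/-- Base sets of the countable product (factors numbered from `0`):
`ν⟨u₀,…,uₘ₋₁⟩ = ν₀(u₀) × … × νₘ₋₁(uₘ₋₁) × Xₘ × Xₘ₊₁ × …`, `m ≥ 1`. -/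
def EffSpace.piNu (X : ℕ → EffSpace.{u} k) (w : Word k) : Set (∀ i, X i) :=
  {x | ∃ l : List (Word k), l ≠ [] ∧ w = tuple l ∧ (∀ i (h : i < l.length), x i ∈ (X i).nu l[i])}

theorem EffSpace.piNu_tuple (X : ℕ → EffSpace.{u} k) {l : List (Word k)} (hl : l ≠ []) :
    EffSpace.piNu X (tuple l) = {x | ∀ i (h : i < l.length), x i ∈ (X i).nu l[i]} := by
  ext x
  constructor
  · rintro ⟨m, _, h, hx⟩
    obtain rfl := tuple_injective h
    exact hx
  · intro hx; exact ⟨l, hl, rfl, hx⟩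

/-- The countable product, with the product topology. -/
def EffSpace.pi (X : ℕ → EffSpace.{u} k) : EffSpace.{u} k where
  carrier := ∀ i, X i
  t0 := inferInstance
  dom := {w | ∃ l : List (Word k), l ≠ [] ∧ w = tuple l ∧
    ∀ i (h : i < l.length), l[i] ∈ (X i).dom}
  nu := EffSpace.piNu X
  nu_off := by
    intro w hw
    rw [Set.eq_empty_iff_forall_notMem]
    rintro x ⟨l, hl, h, hx⟩
    exact hw ⟨l, hl, h, fun i hi => (X i).mem_dom (hx i hi)⟩
  isBase := by
    refine TopologicalSpace.isTopologicalBasis_of_isOpen_of_nhds ?_ ?_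
    · rintro _ ⟨_, ⟨l, hl, rfl, _⟩, rfl⟩
      rw [EffSpace.piNu_tuple X hl]
      have : {x : ∀ i, X i | ∀ i (h : i < l.length), x i ∈ (X i).nu l[i]} =
          ⋂ i : Fin l.length, (fun x : ∀ i, X i => x i) ⁻¹' (X i).nu l[i] := by
        ext x
        simp only [Set.mem_ofPred_eq, Set.mem_iInter, Set.mem_preimage]
        exact ⟨fun h i => h i i.2, fun h i hi => h ⟨i, hi⟩⟩
      rw [this]
      exact isOpen_iInter_of_finite fun i =>
        ((X i).isOpen_nu _).preimage (continuous_apply (i : ℕ))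
    · intro x U hx hU
      obtain ⟨I, V, hV, hVU⟩ := isOpen_pi_iff.1 hU x hx
      have key : ∀ i, ∃ w ∈ (X i).dom, x i ∈ (X i).nu w ∧ (i ∈ I → (X i).nu w ⊆ V i) := by
        intro i
        by_cases hi : i ∈ I
        · obtain ⟨w, h1, h2, h3⟩ := (X i).exists_nu (hV i hi).1 (hV i hi).2
          exact ⟨w, h1, h2, fun _ => h3⟩
        · obtain ⟨w, h1, h2, _⟩ := (X i).exists_nu isOpen_univ (Set.mem_univ (x i))
          exact ⟨w, h1, h2, fun h => absurd h hi⟩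
      choose w hw hxw hwV using key
      have hl : (List.range (I.sup id + 1)).map w ≠ [] := by simp
      refine ⟨_, ⟨_, ⟨(List.range (I.sup id + 1)).map w, hl, rfl, ?_⟩, rfl⟩, ?_, ?_⟩
      · intro i hi; simpa using hw i
      · rw [EffSpace.piNu_tuple X hl]
        intro i hi; simpa using hxw i
      · rw [EffSpace.piNu_tuple X hl]
        intro y hy
        refine hVU fun i hi => hwV i hi ?_
        have hlt : i < I.sup id + 1 := Nat.lt_succ_of_le (Finset.le_sup (f := id) hi)
        have hlen : i < ((List.range (I.sup id + 1)).map w).length := by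
          rw [List.length_map, List.length_range]; exact hlt
        have := hy i hlen
        rwa [List.getElem_map, List.getElem_range] at this

/-! ### Names of spaces and of compact sets -/

/-- The graph of the characteristic function of `dom ν`, as a set of words. -/
def EffSpace.charGraph (X : EffSpace.{u} k) : Set (Word k) :=
  {w | ∃ u, (u ∈ X.dom ∧ w = tuple [u, [1]]) ∨ (u ∉ X.dom ∧ w = tuple [u, [0]])}

/-- The multi-representation `Δ` of the effective topological spaces: `⟨r,s⟩` is a name of `X` if
`r` enumerates the graph of the characteristic function of `dom ν`, and `s` enumerates some
`S ⊆ (dom ν)³` with `ν(u) ∩ ν(v) = ⋃ {ν(w) | (u,v,w) ∈ S}` for `u, v ∈ dom ν`. -/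
def Delta : MultiRep k (EffSpace.{u} k) := fun p X =>
  ∃ r s, p = seqPair r s ∧ Enumerates r X.charGraph ∧
    ∃ S : Set (Word k × Word k × Word k),
      (∀ a ∈ S, a.1 ∈ X.dom ∧ a.2.1 ∈ X.dom ∧ a.2.2 ∈ X.dom) ∧
      Enumerates s ((fun a => tuple [a.1, a.2.1, a.2.2]) '' S) ∧
      ∀ u ∈ X.dom, ∀ v ∈ X.dom, X.nu u ∩ X.nu v = ⋃ w ∈ {w | (u, v, w) ∈ S}, X.nu w

/-- The words `w` that code (through all `v ≪ w`) a finite set of base elements covering `K`. -/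
def EffSpace.finCovers (X : EffSpace.{u} k) (K : Set X) : Set (Word k) :=
  {w | (∀ v, InWord v w → v ∈ X.dom) ∧ K ⊆ ⋃ v ∈ {v | InWord v w}, X.nu v}

/-- The class of pairs `(X,K)` of an effective topological space and a compact subset. -/
structure CompactPair (k : ℕ) where
  space : EffSpace.{u} k
  set : Set space
  isCompact : IsCompact set

/-- The multi-representation `κ^Δ`: `⟨r,s⟩` is a name of `(X,K)` if `r` is a `Δ`-name of `X` and
`s` is a list of all finite base covers of `K`. -/
def kappaDelta : MultiRep k (CompactPair.{u} k) := fun p A =>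
  ∃ r s, p = seqPair r s ∧ Delta r A.space ∧ Enumerates s (A.space.finCovers A.set)

/-! ### Products of pairs -/

/-- `((X₁,K₁),(X₂,K₂)) ↦ (X₁ × X₂, K₁ × K₂)`. -/
def CompactPair.prod (A B : CompactPair.{u} k) : CompactPair.{u} k where
  space := A.space.prod B.space
  set := A.set ×ˢ B.set
  isCompact := A.isCompact.prod B.isCompact

/-- The product of `n + 1` pairs, bracketed to the left as
`((…((X₁ × X₂) × X₃)…) × Xₙ₊₁, (…((K₁ × K₂) × K₃)…) × Kₙ₊₁)`; for one pair it is that pair. -/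
def CompactPair.finProd : (n : ℕ) → (Fin (n + 1) → CompactPair.{u} k) → CompactPair.{u} k
  | 0, A => A 0
  | n + 1, A => (CompactPair.finProd n fun i => A i.castSucc).prod (A (Fin.last (n + 1)))

/-- `((X₁,K₁),(X₂,K₂),…) ↦ (X₁ × X₂ × …, K₁ × K₂ × …)`. -/
def CompactPair.pi (A : ℕ → CompactPair.{u} k) : CompactPair.{u} k where
  space := EffSpace.pi fun i => (A i).space
  set := Set.pi Set.univ fun i => (A i).set
  isCompact := isCompact_univ_pi fun i => (A i).isCompact

end TTE

/-! Each of the three parts of a `kappaDelta`-name is an enumeration of a set of words. It therefore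
suffices to confirm membership in the corresponding set of the product from finite prefixes of the
input (`SemiDec`), uniformly in the input; `SemiDec.exists_enumeration` turns such a confirmation
into an enumeration computed by a machine.

A base word of the product decodes to a finite list of base words of the factors, one for each
initial index, and the three sets are treated in coordinates. Domain: a word belongs to it if it
decodes and all entries are base words. The failure of this is confirmable as well, because the
names of the factors list the graphs of characteristic functions. Intersections: boxes intersect
coordinatewise, so the relations of the factors are combined index by index. Where only one list has
an entry, the other box is unrestricted and the entry is copied. Covers: by distributivity
(`boxes_cover_iff`), boxes cover a product of sets `K i` if and only if for every choice of one side
from each box there is a direction `i` in which the chosen sides cover `K i`. There are finitely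
many choices, and each requirement is confirmed by finding a direction and an entry in the list of
covers of that factor.

A `Scheme` says where the symbols of the factor names sit in the input, and a `ProductCode` presents
the product in coordinates. With these two abstractions a single argument, `Scheme.repComputable`,
serves all three products; a pair is the left-nested finite product with two factors. -/

namespace TTE

variable {k : ℕ}

/-! ### Occurrences of wrapped words -/

theorem iota_eq_cons (w : Word k) :
    iota w = 1 :: 1 :: (w.flatMap (fun a => [0, a]) ++ [0, 1, 1]) := rfl

theorem length_iota (w : Word k) : (iota w).length = 2 * w.length + 5 := by
  simp [iota_eq_cons, List.length_flatMap]; ring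

theorem getElem?_flatMap_zero_cons (w t : Word k) {m : ℕ} (h : m < w.length) :
    (w.flatMap (fun a => [0, a]) ++ t)[2 * m + 1]? = w[m]? := by
  induction w generalizing m with
  | nil => simp at h
  | cons a w ih =>
    cases m with
    | zero => simp
    | succ m =>
      have := ih (m := m) (by simpa using h)
      simpa [Nat.mul_add] using this

theorem getElem?_iota_append (w t : Word k) {m : ℕ} (h : m < w.length) :
    (iota w ++ t)[2 * m + 3]? = w[m]? := by
  have := getElem?_flatMap_zero_cons w ([0, 1, 1] ++ t) h
  simpa [iota_eq_cons] using this

/-- The wrapping is self-delimiting, so at most one wrapped word starts at a given position. -/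
theorem iota_prefix_unique {u v w : Word k} (hu : iota u <+: w) (hv : iota v <+: w) : u = v := by
  obtain ⟨s, rfl⟩ := hu
  obtain ⟨t, ht⟩ := hv
  exact (iota_append_inj ht).1.symm

/-- The word formed by the symbols at the positions `3, 5, …, 2j+1`. -/
def bodyAt (w : Word k) (j : ℕ) : Word k := (List.range j).filterMap fun m => w[2 * m + 3]?

theorem bodyAt_iota_append (v t : Word k) : bodyAt (iota v ++ t) v.length = v := by
  have : bodyAt (iota v ++ t) v.length = (List.range v.length).filterMap fun m => v[m]? :=
    List.filterMap_congr fun m hm => getElem?_iota_append v t (List.mem_range.1 hm)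
  rw [this]
  have key : ∀ n ≤ v.length, (List.range n).filterMap (fun m => v[m]?) = v.take n := by
    intro n hn
    induction n with
    | zero => simp
    | succ n ih =>
      rw [List.range_succ, List.filterMap_append, ih (by omega), List.take_add_one]
      simp [List.getElem?_eq_getElem (show n < v.length by omega)]
  rw [key _ le_rfl, List.take_length]

/-- The word `v`, if any, such that `ι(v)` is a prefix of `w`. -/
def headWord (w : Word k) : Option (Word k) :=
  ((List.range w.length).filterMap fun j =>
    if iota (bodyAt w j) = w.take (2 * j + 5) then some (bodyAt w j) else none).head?

theorem headWord_eq_some {v w : Word k} : headWord w = some v ↔ iota v <+: w := by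
  have sound : ∀ v ∈ (List.range w.length).filterMap (fun j =>
      if iota (bodyAt w j) = w.take (2 * j + 5) then some (bodyAt w j) else none),
      iota v <+: w := by
    intro v hv
    obtain ⟨j, _, hj⟩ := List.mem_filterMap.1 hv
    split_ifs at hj with h
    cases hj
    rw [h]
    exact List.take_prefix _ _
  constructor
  · intro h
    exact sound v (List.mem_of_mem_head? h)
  · intro h
    have hmem : v ∈ (List.range w.length).filterMap (fun j =>
        if iota (bodyAt w j) = w.take (2 * j + 5) then some (bodyAt w j) else none) := by
      obtain ⟨t, rfl⟩ := h
      refine List.mem_filterMap.2 ⟨v.length, ?_, ?_⟩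
      -- The search range suffices, since a word is shorter than its wrapping.
      · simp [length_iota]; omega
      · rw [bodyAt_iota_append, List.take_left' (length_iota v), if_pos rfl]
    unfold headWord
    generalize List.filterMap _ _ = l at hmem sound ⊢
    cases l with
    | nil => simp at hmem
    | cons a l =>
      simp only [List.head?_cons, Option.some.injEq]
      exact iota_prefix_unique (sound a (by simp)) h

theorem headWord_eq_none {w : Word k} (h : ¬ [1, 1, 0] <+: w) : headWord w = none := by
  rw [Option.eq_none_iff_forall_ne_some]
  intro v hv
  refine h (List.IsPrefix.trans ?_ (headWord_eq_some.1 hv))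
  cases v <;> simp [iota_eq_cons]

/-- All words `v ≪ w`, in the order of their occurrences. -/
def parts (w : Word k) : List (Word k) :=
  (List.range w.length).filterMap fun i => headWord (w.drop i)

theorem parts_cons (a : Sym k) (w : Word k) :
    parts (a :: w) = (headWord (a :: w)).toList ++ parts w := by
  simp only [parts, List.length_cons, List.range_succ_eq_map, List.filterMap_cons, List.drop_zero,
    List.filterMap_map]
  have : ((fun i => headWord (List.drop i (a :: w))) ∘ Nat.succ) =
    fun i => headWord (w.drop i) := rfl
  rw [this]
  cases headWord (a :: w) <;> simp

theorem mem_parts {v w : Word k} : v ∈ parts w ↔ InWord v w := by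
  induction w with
  | nil => simp [InWord, iota_eq_cons, parts]
  | cons a w ih =>
    rw [parts_cons, List.mem_append, ih, Option.mem_toList, headWord_eq_some]
    exact List.infix_cons_iff.symm

theorem parts_cons_of_not_prefix {a : Sym k} {w : Word k} (h : ¬ [1, 1, 0] <+: a :: w) :
    parts (a :: w) = parts w := by
  rw [parts_cons, headWord_eq_none h]; rfl

/-- Every occurrence of a wrapped word starts with `110`. In a body `0a₁0a₂…` each position carries
a `0` or is followed by one, so no occurrence can start there; the hypothesis on `t` settles the
last symbol of the body. -/
theorem parts_flatMap_append (u t : Word k) (ht : [0] <+: t) :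
    parts (u.flatMap (fun a => [0, a]) ++ t) = parts t := by
  induction u with
  | nil => rfl
  | cons a u ih =>
    have h0 : [0] <+: u.flatMap (fun a => [0, a]) ++ t := by
      cases u
      · simpa using ht
      · simp
    obtain ⟨s, hs⟩ := h0
    rw [List.flatMap_cons, List.append_assoc, List.cons_append, List.cons_append, List.nil_append,
      parts_cons_of_not_prefix (by simp), parts_cons_of_not_prefix, ih]
    rw [← hs]; simp

/-- Words that may follow a wrapped word without giving rise to further occurrences. -/
def Separates (w : Word k) : Prop := ¬ [0] <+: w ∧ ¬ [1, 0] <+: w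

/-- The only danger is the final `11` of the wrapping: it begins a new `110` at its first symbol if
`0` follows, and at its second symbol if `10` follows. `Separates` excludes both. -/
theorem parts_iota_append (u : Word k) {w : Word k} (hw : Separates w) :
    parts (iota u ++ w) = u :: parts w := by
  have hh : headWord (iota u ++ w) = some u := headWord_eq_some.2 (List.prefix_append _ _)
  have hb : [0] <+: u.flatMap (fun a => [0, a]) ++ ([0, 1, 1] ++ w) := by cases u <;> simp
  rw [iota_eq_cons, List.cons_append, List.cons_append, List.append_assoc] at hh ⊢
  rw [parts_cons, hh, parts_cons_of_not_prefix, parts_flatMap_append _ _ (by simp)]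
  · rw [List.cons_append, parts_cons_of_not_prefix (by simp), List.cons_append,
      parts_cons_of_not_prefix, List.cons_append, parts_cons_of_not_prefix]
    · rfl
    · intro h
      exact hw.2 (by simpa using h)
    · intro h
      exact hw.1 (by simpa using h)
  · obtain ⟨s, hs⟩ := hb
    rw [← hs]; simp

/-- A block of an output sequence: a wrapped word or the filler `1`. -/
def block : Option (Word k) → Word k
  | some v => iota v
  | none => [1]

theorem separates_flatMap_block (l : List (Option (Word k))) : Separates (l.flatMap block) := by
  have h0 : ∀ l : List (Option (Word k)), ¬ [0] <+: l.flatMap block := by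
    intro l
    rcases l with _ | ⟨_ | v, l⟩ <;> simp [block, iota_eq_cons]
  refine ⟨h0 l, ?_⟩
  rcases l with _ | ⟨_ | v, l⟩
  · simp
  · simpa [block] using h0 l
  · simp [block, iota_eq_cons]

/-- No concatenation of blocks begins with `0` or `10`, so neither fillers nor the seams between
blocks create unintended words. -/
theorem parts_flatMap_block (l : List (Option (Word k))) :
    parts (l.flatMap block) = l.reduceOption := by
  induction l with
  | nil => rfl
  | cons b l ih =>
    have hs := separates_flatMap_block l
    cases b with
    | none =>
      rw [List.flatMap_cons, block, List.cons_append, List.nil_append, parts_cons_of_not_prefix, ih]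
      · rfl
      · intro h
        have h' : [1, 0] <+: l.flatMap block := by simpa using h
        exact hs.2 h'
    | some v => rw [List.flatMap_cons, block, parts_iota_append v hs, ih]; rfl

theorem tuple_eq_flatMap_block (l : List (Word k)) : tuple l = (l.map some).flatMap block := by
  rw [List.flatMap_map]; rfl

theorem parts_tuple (l : List (Word k)) : parts (tuple l) = l := by
  rw [tuple_eq_flatMap_block, parts_flatMap_block]
  simp [List.reduceOption]

theorem inWord_tuple {v : Word k} {l : List (Word k)} : InWord v (tuple l) ↔ v ∈ l := by
  rw [← mem_parts, parts_tuple]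

theorem inWord_flatMap_block {v : Word k} {l : List (Option (Word k))} :
    InWord v (l.flatMap block) ↔ some v ∈ l := by
  rw [← mem_parts, parts_flatMap_block, List.reduceOption_mem_iff]

/-- The list coded by a tuple of words. -/
def untuple (w : Word k) : Option (List (Word k)) :=
  if tuple (parts w) = w then some (parts w) else none

theorem untuple_eq_some {w : Word k} {l : List (Word k)} : untuple w = some l ↔ w = tuple l := by
  unfold untuple
  constructor
  · intro h
    split_ifs at h with h'
    cases h
    exact h'.symm
  · rintro rfl
    simp [parts_tuple]

@[simp] theorem untuple_tuple (l : List (Word k)) : untuple (tuple l) = some l :=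
  untuple_eq_some.2 rfl

/-! ### Primitive recursiveness of the operations on words -/

open Primrec

theorem primrec_iota : Primrec (iota (k := k)) :=
  list_append.comp (list_append.comp (.const _) (list_flatMap .id
    (list_cons.comp (.const _) (list_cons.comp .snd (.const _))).to₂)) (.const _)

theorem primrec_tuple : Primrec (tuple (k := k)) :=
  list_flatMap .id (primrec_iota.comp .snd).to₂

theorem primrec_bodyAt : Primrec₂ (bodyAt (k := k)) :=
  listFilterMap (list_range.comp .snd) (list_getElem?.comp (Primrec.fst.comp .fst)
    (nat_add.comp (nat_mul.comp (.const 2) .snd) (.const 3))).to₂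

theorem primrec_headWord : Primrec (headWord (k := k)) := by
  refine list_head?.comp (listFilterMap (list_range.comp list_length) ?_)
  have hb : Primrec fun q : Word k × ℕ => bodyAt q.1 q.2 := primrec_bodyAt
  exact Primrec.ite (Primrec.eq.comp (primrec_iota.comp hb)
    (list_take.comp (nat_add.comp (nat_mul.comp (.const 2) .snd) (.const 5)) .fst))
    (option_some.comp hb) (.const none)

theorem primrec_parts : Primrec (parts (k := k)) :=
  listFilterMap (list_range.comp list_length)
    (primrec_headWord.comp (list_drop.comp .snd .fst)).to₂

theorem primrec_untuple : Primrec (untuple (k := k)) :=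
  Primrec.ite (Primrec.eq.comp (primrec_tuple.comp primrec_parts) .id)
    (option_some.comp primrec_parts) (.const none)

theorem primrec_sections {α : Type*} [Primcodable α] : Primrec (List.sections (α := α)) := by
  have : Primrec fun L : List (List α) => L.foldr
      (fun l acc => acc.flatMap fun s => l.map fun a => a :: s) [[]] :=
    list_foldr .id (.const _) (list_flatMap (Primrec.snd.comp .snd)
      (list_map (Primrec.fst.comp (Primrec.snd.comp .fst))
        (list_cons.comp .snd (Primrec.snd.comp .fst)).to₂).to₂).to₂
  refine this.of_eq fun L => ?_
  induction L with
  | nil => rfl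
  | cons l L ih => rw [List.foldr_cons, ih]; rfl

open Filter

/-! ### Prefixes and tuples of sequences -/

@[simp] theorem length_pre (p : Seq k) (n : ℕ) : (pre p n).length = n := by simp [pre]

theorem pre_succ (p : Seq k) (n : ℕ) : pre p (n + 1) = pre p n ++ [p n] := by
  simp [pre, List.range_succ]

theorem getElem?_pre (p : Seq k) (n i : ℕ) : (pre p n)[i]? = if i < n then some (p i) else none := by
  simp [pre]
  split_ifs <;> simp [*]

theorem take_pre (p : Seq k) {m n : ℕ} (h : m ≤ n) : (pre p n).take m = pre p m := by
  simp [pre, ← List.map_take, List.take_range, h]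

theorem seqPair_apply (p q : Seq k) (n : ℕ) :
    seqPair p q n = if n % 2 = 0 then p (n / 2) else q (n / 2) := by
  unfold seqPair seqTuple
  rcases Nat.mod_two_eq_zero_or_one n with h | h
  · have : Fin.ofNat 2 n = 0 := Fin.ext h
    rw [this]; simp only [h]; rfl
  · have : Fin.ofNat 2 n = 1 := Fin.ext h
    rw [this]; simp only [h]; rfl

theorem seqPair_even (p q : Seq k) (n : ℕ) : seqPair p q (2 * n) = p n := by
  simp [seqPair_apply]

theorem seqPair_odd (p q : Seq k) (n : ℕ) : seqPair p q (2 * n + 1) = q n := by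
  rw [seqPair_apply, if_neg (by omega)]; congr 1; omega

/-- Searching for a starting position and then comparing finitely many single symbols is the form to
which the closure properties of `SemiDec` apply. -/
theorem inSeq_iff {x : Word k} {r : Seq k} :
    InSeq x r ↔ ∃ c, ∀ i ∈ List.range (iota x).length, (iota x)[i]? = some (r (c + i)) := by
  have hmap : ∀ c n, (pre r (c + n)) = pre r c ++ (List.range n).map fun i => r (c + i) := by
    intro c n
    simp [pre, List.range_add]
  constructor
  · rintro ⟨n, s, t, h⟩
    refine ⟨s.length, fun i hi => ?_⟩
    have hi' := List.mem_range.1 hi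
    have hn : s.length + i < n := by
      have := congrArg List.length h
      simp at this
      omega
    have h2 := getElem?_pre r n (s.length + i)
    rw [← h, if_pos hn, List.append_assoc, List.getElem?_append_right (by omega)] at h2
    rw [← h2, List.getElem?_append_left (by omega)]
    congr 1; omega
  · rintro ⟨c, hc⟩
    refine ⟨c + (iota x).length, pre r c, [], ?_⟩
    rw [hmap, List.append_nil]
    congr 1
    apply List.ext_getElem?
    intro i
    by_cases hi : i < (iota x).length
    · rw [hc i (List.mem_range.2 hi)]; simp [hi]
    · rw [List.getElem?_eq_none (by omega), List.getElem?_eq_none (by simpa using hi)]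

/-! ### Machines that write one symbol for every symbol read -/

/-- A map on sequences whose `n`-th output symbol is a primitive recursive function of the first
`n + 1` input symbols. -/
def Causal (F : Seq k → Seq k) : Prop :=
  ∃ G : Word k → Sym k, Primrec G ∧ ∀ p n, F p n = G (pre p (n + 1))

/-- Output is only ever appended, so any two finite outputs of a run are comparable. This gives the
direction of `ComputableSeqFun` in which a written sequence must be the value. -/
theorem writes_unique {M : Machine k} {p q q' : Seq k} (h : M.Writes p q) (h' : M.Writes p q') :
    q = q' := by
  have mono : ∀ s t, s ≤ t → (M.run p s).out <+: (M.run p t).out := by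
    intro s t hst
    induction t, hst using Nat.le_induction with
    | base => exact List.prefix_rfl
    | succ t _ ih => exact ih.trans (List.prefix_append _ _)
  funext n
  obtain ⟨s, hs⟩ := h (n + 1)
  obtain ⟨t, ht⟩ := h' (n + 1)
  have h1 := hs.trans (mono s (max s t) (le_max_left _ _))
  have h2 := ht.trans (mono t (max s t) (le_max_right _ _))
  have := List.prefix_of_prefix_length_le h1 h2 (by simp)
  have := this.eq_of_length (by simp)
  have := congrArg (fun w : Word k => w[n]?) this
  simp only [getElem?_pre, Nat.lt_succ_self, if_true] at this
  exact Option.some_injective _ this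

theorem Causal.computableSeqFun {F : Seq k → Seq k} (hF : Causal F) :
    ComputableSeqFun fun p => Part.some (F p) := by
  obtain ⟨G, hG, hFG⟩ := hF
  -- The memory holds all input read so far; every step reads one symbol and writes one symbol.
  let M : Machine k :=
    { Mem := Word k
      init := []
      step := fun c => (c.1 ++ [c.2], true, some (G (c.1 ++ [c.2])))
      step_computable := by
        have h : Primrec fun c : Word k × Sym k => c.1 ++ [c.2] := list_concat
        exact (Primrec.pair h (Primrec.pair (.const true) (option_some.comp (hG.comp h)))).to_comp }
  have hrun : ∀ p n, M.run p n = ⟨pre p n, n, pre (F p) n⟩ := by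
    intro p n
    induction n with
    | zero => rfl
    | succ n ih =>
      rw [Machine.run, ih, pre_succ p, pre_succ (F p), hFG, pre_succ p]
      rfl
  have hw : ∀ p, M.Writes p (F p) := fun p n => ⟨n, by rw [hrun]⟩
  refine ⟨M, fun p q => ⟨fun h => ?_, fun h => ?_⟩⟩
  · rw [Part.mem_some_iff.1 h]; exact hw p
  · exact Part.mem_some_iff.2 (writes_unique h (hw p))

/-- Symbol `n` of the pair is symbol `n / 2` of a component, which depends on even fewer input
symbols than are available. -/
theorem Causal.seqPair {F₁ F₂ : Seq k → Seq k} (h₁ : Causal F₁) (h₂ : Causal F₂) :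
    Causal fun p => seqPair (F₁ p) (F₂ p) := by
  obtain ⟨G₁, hG₁, h₁⟩ := h₁
  obtain ⟨G₂, hG₂, h₂⟩ := h₂
  have hn : Primrec fun w : Word k => w.length - 1 := nat_sub.comp list_length (.const 1)
  have ht : Primrec fun w : Word k => w.take ((w.length - 1) / 2 + 1) :=
    list_take.comp (Primrec.succ.comp (nat_div.comp hn (.const 2))) .id
  refine ⟨fun w => if (w.length - 1) % 2 = 0 then G₁ (w.take ((w.length - 1) / 2 + 1))
    else G₂ (w.take ((w.length - 1) / 2 + 1)),
    Primrec.ite (Primrec.eq.comp (nat_mod.comp hn (.const 2)) (.const 0))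
      (hG₁.comp ht) (hG₂.comp ht), fun p n => ?_⟩
  dsimp only
  rw [seqPair_apply, length_pre, Nat.add_sub_cancel, take_pre p (by omega), h₁, h₂]

/-! ### Sequences made of blocks -/

/-- The concatenation of the first `n` blocks. -/
def blockText (b : ℕ → Option (Word k)) (n : ℕ) : Word k := (List.range n).flatMap fun i => block (b i)

/-- The infinite concatenation of blocks. -/
def blockSeq (b : ℕ → Option (Word k)) : Seq k := fun n => (blockText b (n + 1)).getD n 1

theorem blockText_succ (b : ℕ → Option (Word k)) (n : ℕ) :
    blockText b (n + 1) = blockText b n ++ block (b n) := by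
  simp [blockText, List.range_succ]

/-- No block is empty, which is the purpose of the filler. Hence the first `n` blocks determine the
first `n` symbols, and the default value in `blockSeq` is never used. -/
theorem le_length_blockText (b : ℕ → Option (Word k)) (n : ℕ) : n ≤ (blockText b n).length := by
  induction n with
  | zero => simp
  | succ n ih =>
    have : 1 ≤ (block (b n)).length := by cases b n <;> simp [block, length_iota]
    rw [blockText_succ, List.length_append]; omega

theorem blockText_prefix (b : ℕ → Option (Word k)) {m n : ℕ} (h : m ≤ n) :
    blockText b m <+: blockText b n := by
  induction n, h using Nat.le_induction with
  | base => exact List.prefix_rfl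
  | succ n _ ih => rw [blockText_succ]; exact ih.trans (List.prefix_append _ _)

theorem pre_blockSeq (b : ℕ → Option (Word k)) (n : ℕ) :
    pre (blockSeq b) n <+: blockText b n := by
  induction n with
  | zero => simp [pre]
  | succ n ih =>
    have hlen := le_length_blockText b (n + 1)
    have h : pre (blockSeq b) n = (blockText b (n + 1)).take n := by
      have := List.prefix_iff_eq_take.1 (ih.trans (blockText_prefix b (Nat.le_succ n)))
      simpa using this
    have : pre (blockSeq b) (n + 1) = (blockText b (n + 1)).take (n + 1) := by
      rw [pre_succ, h, List.take_add_one, blockSeq, List.getD_eq_getElem?_getD,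
        List.getElem?_eq_getElem (by omega)]
      rfl
    rw [this]; exact List.take_prefix _ _

theorem enumerates_blockSeq (b : ℕ → Option (Word k)) :
    Enumerates (blockSeq b) {v | ∃ i, b i = some v} := by
  have hin : ∀ v n, InWord v (blockText b n) ↔ ∃ i < n, b i = some v := by
    intro v n
    have : blockText b n = ((List.range n).map b).flatMap block := by
      rw [List.flatMap_map]; rfl
    rw [this, inWord_flatMap_block]
    simp
  intro v
  constructor
  · rintro ⟨n, hn⟩
    obtain ⟨i, _, hi⟩ := (hin v n).1 (hn.trans (pre_blockSeq b n).isInfix)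
    exact ⟨i, hi⟩
  · rintro ⟨i, hi⟩
    have h1 := (hin v (i + 1)).2 ⟨i, by omega, hi⟩
    set N := (blockText b (i + 1)).length with hN
    have hle : i + 1 ≤ N := le_length_blockText b (i + 1)
    refine ⟨N, h1.trans (List.IsPrefix.isInfix ?_)⟩
    exact List.prefix_of_prefix_length_le (blockText_prefix b hle) (pre_blockSeq b N) (by simp [hN])

/-! ### Predicates that are semi-decidable relative to a sequence -/

/-- The predicate `φ p a` can be confirmed by inspecting a finite prefix of `p`. -/
def SemiDec {α : Type*} [Primcodable α] (φ : Seq k → α → Prop) : Prop :=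
  ∃ R : Word k → α → Prop, PrimrecRel R ∧ (∀ p n a, R (pre p n) a → φ p a) ∧
    ∀ p a, φ p a → ∀ᶠ n in atTop, R (pre p n) a

namespace SemiDec

variable {α β : Type*} [Primcodable α] [Primcodable β]

theorem of_iff {φ ψ : Seq k → α → Prop} (h : SemiDec φ) (H : ∀ p a, ψ p a ↔ φ p a) :
    SemiDec ψ := by
  obtain rfl : ψ = φ := by funext p a; exact propext (H p a)
  exact h

theorem of_primrec {φ : α → Prop} (h : PrimrecPred φ) : SemiDec fun (_ : Seq k) a => φ a :=
  ⟨fun _ a => φ a, h.comp .snd, fun _ _ _ h => h, fun _ _ h => .of_forall fun _ => h⟩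

theorem comp {φ : Seq k → β → Prop} (h : SemiDec φ) {f : α → β} (hf : Primrec f) :
    SemiDec fun p a => φ p (f a) := by
  obtain ⟨R, hR, h1, h2⟩ := h
  exact ⟨fun w a => R w (f a), hR.comp .fst (hf.comp .snd), fun p n a => h1 p n _,
    fun p a => h2 p _⟩

/-- Confirmation at all sufficiently long prefixes, rather than at some prefix, is what makes two
confirmations available at a common length. -/
theorem and {φ ψ : Seq k → α → Prop} (hφ : SemiDec φ) (hψ : SemiDec ψ) :
    SemiDec fun p a => φ p a ∧ ψ p a := by
  obtain ⟨R, hR, h1, h2⟩ := hφ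
  obtain ⟨R', hR', h1', h2'⟩ := hψ
  exact ⟨fun w a => R w a ∧ R' w a, PrimrecPred.and hR hR',
    fun p n a h => ⟨h1 p n a h.1, h1' p n a h.2⟩, fun p a h => (h2 p a h.1).and (h2' p a h.2)⟩

theorem or {φ ψ : Seq k → α → Prop} (hφ : SemiDec φ) (hψ : SemiDec ψ) :
    SemiDec fun p a => φ p a ∨ ψ p a := by
  obtain ⟨R, hR, h1, h2⟩ := hφ
  obtain ⟨R', hR', h1', h2'⟩ := hψ
  exact ⟨fun w a => R w a ∨ R' w a, PrimrecPred.or hR hR',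
    fun p n a h => h.imp (h1 p n a) (h1' p n a),
    fun p a h => h.elim (fun h => (h2 p a h).mono fun _ => Or.inl)
      fun h => (h2' p a h).mono fun _ => Or.inr⟩

/-- At a prefix of length `n` the candidates with codes below `n` are tried; a witness is eventually
among them and eventually confirmed. -/
theorem ex {φ : Seq k → α → β → Prop} (h : SemiDec fun p (x : α × β) => φ p x.1 x.2) :
    SemiDec fun p a => ∃ b, φ p a b := by
  obtain ⟨R, hR, h1, h2⟩ := h
  refine ⟨fun w a => ∃ b ∈ (List.range w.length).filterMap (Encodable.decode (α := β)),
    R w (a, b), ?_, ?_, ?_⟩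
  · have hS : PrimrecRel fun (b : β) (x : Word k × α) => R x.1 (x.2, b) :=
      hR.comp (Primrec.fst.comp .snd) (Primrec.pair (Primrec.snd.comp .snd) .fst)
    exact hS.exists_mem_list.comp (listFilterMap (list_range.comp (list_length.comp .fst))
      (Primrec.decode.comp .snd).to₂) .id
  · rintro p n a ⟨b, _, hb⟩
    exact ⟨b, h1 p n (a, b) hb⟩
  · rintro p a ⟨b, hb⟩
    filter_upwards [h2 p (a, b) hb, eventually_gt_atTop (Encodable.encode b)] with n hn hlt
    exact ⟨b, List.mem_filterMap.2 ⟨Encodable.encode b, by simpa using hlt,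
      Encodable.encodek b⟩, hn⟩

theorem all {φ : Seq k → α → β → Prop} {F : α → List β} (hF : Primrec F)
    (h : SemiDec fun p (x : α × β) => φ p x.1 x.2) :
    SemiDec fun p a => ∀ b ∈ F a, φ p a b := by
  obtain ⟨R, hR, h1, h2⟩ := h
  refine ⟨fun w a => ∀ b ∈ F a, R w (a, b), ?_, ?_, ?_⟩
  · have hS : PrimrecRel fun (b : β) (x : Word k × α) => R x.1 (x.2, b) :=
      hR.comp (Primrec.fst.comp .snd) (Primrec.pair (Primrec.snd.comp .snd) .fst)
    exact hS.forall_mem_list.comp (hF.comp .snd) .id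
  · intro p n a h b hb
    exact h1 p n (a, b) (h b hb)
  · intro p a h
    have := (Set.Finite.eventually_all (l := atTop) (List.finite_toSet (F a))
      (p := fun b n => R (pre p n) (a, b))).2 fun b hb => h2 p (a, b) (h b hb)
    exact this

theorem symbol {f : α → ℕ} {g : α → Option (Sym k)} (hf : Primrec f) (hg : Primrec g) :
    SemiDec fun (p : Seq k) a => g a = some (p (f a)) := by
  -- The second conjunct prevents a prefix that is too short from confirming `none = none`.
  refine ⟨fun w a => w[f a]? = g a ∧ g a ≠ none, ?_, ?_, ?_⟩
  · exact PrimrecPred.and (Primrec.eq.comp (list_getElem?.comp .fst (hf.comp .snd)) (hg.comp .snd))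
      (PrimrecPred.not (Primrec.eq.comp (hg.comp .snd) (.const none)))
  · rintro p n a ⟨h, h'⟩
    rw [getElem?_pre] at h
    split_ifs at h
    · exact h.symm
    · exact absurd h.symm h'
  · intro p a h
    filter_upwards [eventually_gt_atTop (f a)] with n hn
    rw [getElem?_pre, if_pos hn, h]
    exact ⟨rfl, by simp⟩

/-- Occurrence of a word in a subsequence of the input. -/
theorem inSeq {pos : α → ℕ → ℕ} {f : α → Word k} (hpos : Primrec₂ pos) (hf : Primrec f) :
    SemiDec fun (p : Seq k) a => InSeq (f a) fun j => p (pos a j) := by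
  have hi : Primrec fun x : (α × ℕ) × ℕ => iota (f x.1.1) :=
    primrec_iota.comp (hf.comp (Primrec.fst.comp .fst))
  have h : SemiDec fun (p : Seq k) (x : (α × ℕ) × ℕ) =>
      (iota (f x.1.1))[x.2]? = some (p (pos x.1.1 (x.1.2 + x.2))) :=
    symbol (hpos.comp (Primrec.fst.comp .fst) (nat_add.comp (Primrec.snd.comp .fst) .snd))
      (list_getElem?.comp hi .snd)
  exact (ex (all (F := fun x : α × ℕ => List.range (iota (f x.1)).length)
    (list_range.comp (list_length.comp (primrec_iota.comp (hf.comp .fst)))) h)).of_iff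
    fun p a => inSeq_iff

/-- Dovetailing: stage `n` tests the word coded by the first component of `n.unpair` on the prefix
of length `n`, and emits that word or a filler. Every word is tested at arbitrarily late stages. -/
theorem exists_enumeration {φ : Seq k → Word k → Prop} (h : SemiDec φ) :
    ∃ F : Seq k → Seq k, Causal F ∧ ∀ p, Enumerates (F p) {w | φ p w} := by
  classical
  obtain ⟨R, hR, h1, h2⟩ := h
  let stage : Word k → Option (Word k) := fun w =>
    (Encodable.decode (α := Word k) w.length.unpair.1).bind fun x =>
      if R w x then some x else none
  have hstage : Primrec stage := option_bind
    (Primrec.decode.comp (Primrec.fst.comp (Primrec.unpair.comp list_length)))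
    (Primrec.ite hR (option_some.comp .snd) (.const none)).to₂
  have hblock : Primrec (block (k := k)) := by
    refine (option_casesOn (o := fun o : Option (Word k) => o) .id (.const [1])
      (primrec_iota.comp .snd).to₂).of_eq fun o => ?_
    cases o <;> rfl
  refine ⟨fun p => blockSeq fun n => stage (pre p n), ⟨fun w =>
    ((List.range w.length).flatMap fun i => block (stage (w.take i))).getD (w.length - 1) 1,
    ?_, ?_⟩, ?_⟩
  · exact (list_getD 1).comp (list_flatMap (list_range.comp list_length)
      (hblock.comp (hstage.comp (list_take.comp .snd .fst))).to₂)
      (nat_sub.comp list_length (.const 1))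
  · intro p n
    simp only [blockSeq, blockText, length_pre, Nat.add_sub_cancel]
    congr 1
    refine List.flatMap_congr fun i hi => ?_
    rw [take_pre p (List.mem_range.1 hi).le]
  · intro p
    convert enumerates_blockSeq _ using 1
    ext x
    constructor
    · intro hx
      obtain ⟨N, hN⟩ := eventually_atTop.1 (h2 p x hx)
      -- This stage tests `x`, and it is at least `N`, so the confirmation has already set in.
      refine ⟨Nat.pair (Encodable.encode x) N, ?_⟩
      simp [stage, hN _ (Nat.right_le_pair _ _)]
    · rintro ⟨n, hn⟩
      obtain ⟨y, _, hy⟩ := Option.bind_eq_some_iff.1 hn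
      split_ifs at hy with h
      cases hy
      exact h1 p n _ h

end SemiDec

/-! ### Products presented by coordinates -/

/-- A presentation of `Z` as the product of the pairs `B i`, where `i` ranges over the indices with
`P i`; the base words of `Z` are decoded by `D` to lists of base words of the factors. -/
structure ProductCode (Z : CompactPair.{u} k) (B : ℕ → CompactPair.{u} k) (P : ℕ → Prop)
    (D : Word k → Option (List (Word k))) where
  point : (∀ i, P i → (B i).space) → Z.space
  point_surjective : Function.Surjective point
  index : ∀ {w l}, D w = some l → ∀ i < l.length, P i
  -- Decodability depends only on the length; this provides a code for a refinement built coordinate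
  -- by coordinate.
  exists_code : ∀ {w l l'}, D w = some l → l'.length = l.length → ∃ w', D w' = some l'
  mem_dom : ∀ w, w ∈ Z.space.dom ↔
    ∃ l, D w = some l ∧ ∀ i < l.length, l.getD i [] ∈ (B i).space.dom
  mem_nu : ∀ {w l}, D w = some l → ∀ x, point x ∈ Z.space.nu w ↔
    ∀ i < l.length, ∀ hi : P i, x i hi ∈ (B i).space.nu (l.getD i [])
  mem_set : ∀ x, point x ∈ Z.set ↔ ∀ i (hi : P i), x i hi ∈ (B i).set

/-! ### Covers of a product by finitely many boxes -/

/-- The entries of a list together with their indices. -/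
def indexed (l : List (Word k)) : List (ℕ × Word k) :=
  (List.range l.length).map fun i => (i, l.getD i [])

theorem mem_indexed {l : List (Word k)} {y : ℕ × Word k} :
    y ∈ indexed l ↔ y.1 < l.length ∧ y.2 = l.getD y.1 [] := by
  obtain ⟨i, v⟩ := y
  simp only [indexed, List.mem_map, List.mem_range, Prod.mk.injEq]
  constructor
  · rintro ⟨j, hj, rfl, rfl⟩
    exact ⟨hj, rfl⟩
  · rintro ⟨hi, rfl⟩
    exact ⟨i, hi, rfl, rfl⟩

/-- The words that carry the index `i`. -/
def select (c : List (ℕ × Word k)) (i : ℕ) : List (Word k) :=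
  c.filterMap fun y => if y.1 = i then some y.2 else none

theorem mem_select {c : List (ℕ × Word k)} {i : ℕ} {v : Word k} :
    v ∈ select c i ↔ (i, v) ∈ c := by
  simp only [select, List.mem_filterMap, Prod.exists]
  constructor
  · rintro ⟨j, x, h, hx⟩
    split_ifs at hx with hj
    cases hx
    exact hj ▸ h
  · intro h
    exact ⟨i, v, h, by simp⟩

theorem mem_sections_indexed {L : List (List (Word k))} {c : List (ℕ × Word k)}
    (hc : c ∈ (L.map indexed).sections) :
    (∀ l ∈ L, ∃ y ∈ c, y ∈ indexed l) ∧ ∀ y ∈ c, ∃ l ∈ L, y ∈ indexed l := by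
  have h := List.mem_sections.1 hc
  clear hc
  induction L generalizing c with
  | nil =>
    cases h
    simp
  | cons l L ih =>
    cases h with
    | cons hy ht =>
      obtain ⟨h1, h2⟩ := ih ht
      constructor
      · intro m hm
        rcases List.mem_cons.1 hm with rfl | hm
        · exact ⟨_, List.mem_cons_self, hy⟩
        · obtain ⟨y, hy1, hy2⟩ := h1 m hm
          exact ⟨y, List.mem_cons_of_mem _ hy1, hy2⟩
      · intro y hm
        rcases List.mem_cons.1 hm with rfl | hm
        · exact ⟨l, List.mem_cons_self, hy⟩
        · obtain ⟨m, hm1, hm2⟩ := h2 y hm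
          exact ⟨m, List.mem_cons_of_mem _ hm1, hm2⟩

theorem map_mem_sections_indexed {L : List (List (Word k))} {f : List (Word k) → ℕ}
    (hf : ∀ l ∈ L, f l < l.length) :
    L.map (fun l => (f l, l.getD (f l) [])) ∈ (L.map indexed).sections := by
  rw [List.mem_sections]
  induction L with
  | nil => exact .nil
  | cons l L ih =>
    exact .cons (mem_indexed.2 ⟨hf l List.mem_cons_self, rfl⟩)
      (ih fun m hm => hf m (List.mem_cons_of_mem _ hm))

/-- Distributivity: a product of sets is covered by finitely many boxes if and only if for every
choice of one side from each box, the sides chosen in some direction cover the factor. -/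
theorem boxes_cover_iff {X : ℕ → Type*} {P : ℕ → Prop} (K : ∀ i, Set (X i))
    (N : ∀ i, Word k → Set (X i)) {L : List (List (Word k))}
    (hL : ∀ l ∈ L, ∀ i < l.length, P i) :
    (∀ x : ∀ i, P i → X i, (∀ i hi, x i hi ∈ K i) →
      ∃ l ∈ L, ∀ i < l.length, ∀ hi : P i, x i hi ∈ N i (l.getD i [])) ↔
    ∀ c ∈ (L.map indexed).sections, ∃ i, P i ∧ K i ⊆ ⋃ v ∈ {v | v ∈ select c i}, N i v := by
  constructor
  · intro h c hc
    -- If a choice covers in no direction, a point of each `K i` missed by the chosen sides can be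
    -- picked. The resulting point of the product lies in some box, hence also in the side chosen
    -- from that box.
    by_contra! hno
    have : ∀ i, P i → ∃ x ∈ K i, ∀ v ∈ select c i, x ∉ N i v := by
      intro i hi
      obtain ⟨x, hx, hx'⟩ := Set.not_subset.1 (hno i hi)
      exact ⟨x, hx, fun v hv hxv => hx' (Set.mem_biUnion (t := N i) hv hxv)⟩
    choose x hxK hxN using this
    obtain ⟨l, hl, hlx⟩ := h x hxK
    obtain ⟨⟨i, v⟩, hy, hyl⟩ := (mem_sections_indexed hc).1 l hl
    obtain ⟨hi, hv⟩ := mem_indexed.1 hyl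
    dsimp only at hi hv
    subst hv
    exact hxN i (hL l hl i hi) _ (mem_select.2 hy) (hlx i hi (hL l hl i hi))
  · intro h x hx
    -- A point outside all boxes violates some side `f l` of each box `l`. For the choice given by
    -- `f` some direction is covered, which puts the point into a side it violates.
    by_contra! hno
    have : ∀ l, ∃ j, l ∈ L → j < l.length ∧ ∃ hj : P j, x j hj ∉ N j (l.getD j []) := by
      intro l
      by_cases hl : l ∈ L
      · obtain ⟨i, hi, hP, hxi⟩ := hno l hl
        exact ⟨i, fun _ => ⟨hi, hP, hxi⟩⟩
      · exact ⟨0, fun h => absurd h hl⟩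
    choose f hf using this
    obtain ⟨i, hi, hK⟩ := h _ (map_mem_sections_indexed fun l hl => (hf l hl).1)
    obtain ⟨v, hv, hxv⟩ := Set.mem_iUnion₂.1 (hK (hx i hi))
    obtain ⟨l, hl, hlv⟩ := List.mem_map.1 (mem_select.1 hv)
    obtain ⟨rfl, rfl⟩ := Prod.mk.inj hlv
    obtain ⟨_, _, hn⟩ := hf l hl
    exact hn hxv

/-! ### Uniform access to names of the factors -/

/-- A way of reading a sequence as a name of a family: `mode p n` says that `p` has the format `n`;
in this format the `j`-th symbol of the `i`-th name is found at the position `pos (n, i) j`, the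
indices are those with `idx n i`, and the base words of the product are decoded by `dec n`. -/
structure Scheme (k : ℕ) where
  mode : Seq k → ℕ → Prop
  pos : ℕ × ℕ → ℕ → ℕ
  idx : ℕ → ℕ → Prop
  dec : ℕ → Word k → Option (List (Word k))
  semiDec_mode : SemiDec mode
  primrec_pos : Primrec₂ pos
  primrec_idx : PrimrecRel idx
  primrec_dec : Primrec₂ dec

namespace Scheme

variable (C : Scheme k)

/-- The part of the `i`-th name that lists the domain of the base notation. -/
def domSeq (p : Seq k) (a : ℕ × ℕ) : Seq k := fun j => p (C.pos a (2 * (2 * j)))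

/-- The part of the `i`-th name that lists the intersections of base sets. -/
def capSeq (p : Seq k) (a : ℕ × ℕ) : Seq k := fun j => p (C.pos a (2 * (2 * j + 1)))

/-- The part of the `i`-th name that lists the finite covers. -/
def coverSeq (p : Seq k) (a : ℕ × ℕ) : Seq k := fun j => p (C.pos a (2 * j + 1))

section SemiDec

variable {α : Type*} [Primcodable α] {a : α → ℕ × ℕ} {f : α → Word k}

theorem semiDec_domSeq (ha : Primrec a) (hf : Primrec f) :
    SemiDec fun p x => InSeq (f x) (C.domSeq p (a x)) :=
  SemiDec.inSeq (C.primrec_pos.comp (ha.comp .fst)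
    (nat_double.comp (nat_double.comp .snd))).to₂ hf

theorem semiDec_capSeq (ha : Primrec a) (hf : Primrec f) :
    SemiDec fun p x => InSeq (f x) (C.capSeq p (a x)) :=
  SemiDec.inSeq (C.primrec_pos.comp (ha.comp .fst)
    (nat_double.comp (nat_double_succ.comp .snd))).to₂ hf

theorem semiDec_coverSeq (ha : Primrec a) (hf : Primrec f) :
    SemiDec fun p x => InSeq (f x) (C.coverSeq p (a x)) :=
  SemiDec.inSeq (C.primrec_pos.comp (ha.comp .fst) (nat_double_succ.comp .snd)).to₂ hf

theorem primrec_tuple₂ {f g : α → Word k} (hf : Primrec f) (hg : Primrec g) :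
    Primrec fun x => tuple [f x, g x] :=
  primrec_tuple.comp (list_cons.comp hf (list_cons.comp hg (.const _)))

theorem primrec_tuple₃ {f g h : α → Word k} (hf : Primrec f) (hg : Primrec g) (hh : Primrec h) :
    Primrec fun x => tuple [f x, g x, h x] :=
  primrec_tuple.comp (list_cons.comp hf (list_cons.comp hg (list_cons.comp hh (.const _))))

end SemiDec

/-- All entries of a list are listed as base words of the factors. -/
def AllDom (p : Seq k) (y : ℕ × List (Word k)) : Prop :=
  ∀ i ∈ List.range y.2.length, InSeq (tuple [y.2.getD i [], [1]]) (C.domSeq p (y.1, i))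

/-- Some entry of a list is listed as not being a base word of its factor. -/
def SomeNotDom (p : Seq k) (y : ℕ × List (Word k)) : Prop :=
  ∃ i, i < y.2.length ∧ InSeq (tuple [y.2.getD i [], [0]]) (C.domSeq p (y.1, i))

theorem semiDec_allDom : SemiDec C.AllDom := by
  refine SemiDec.all (F := fun y : ℕ × List (Word k) => List.range y.2.length)
    (list_range.comp (list_length.comp .snd)) ?_
  exact C.semiDec_domSeq (Primrec.pair (Primrec.fst.comp .fst) .snd)
    (primrec_tuple₂ ((list_getD []).comp (Primrec.snd.comp .fst) .snd) (.const _))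

theorem semiDec_someNotDom : SemiDec C.SomeNotDom := by
  refine SemiDec.ex (SemiDec.and (SemiDec.of_primrec
    (nat_lt.comp .snd (list_length.comp (Primrec.snd.comp .fst)))) ?_)
  exact C.semiDec_domSeq (Primrec.pair (Primrec.fst.comp .fst) .snd)
    (primrec_tuple₂ ((list_getD []).comp (Primrec.snd.comp .fst) .snd) (.const _))

/-- The words confirmed to be in the graph of the characteristic function of the domain. -/
def CharPred (p : Seq k) (w : Word k) : Prop :=
  ∃ y : ℕ × Word k × List (Word k), C.mode p y.1 ∧
    ((w = tuple [y.2.1, [1]] ∧ C.dec y.1 y.2.1 = some y.2.2) ∧ C.AllDom p (y.1, y.2.2) ∨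
      w = tuple [y.2.1, [0]] ∧ (C.dec y.1 y.2.1 = none ∨
        C.dec y.1 y.2.1 = some y.2.2 ∧ C.SomeNotDom p (y.1, y.2.2)))

theorem semiDec_charPred : SemiDec C.CharPred := by
  have hn : Primrec fun x : Word k × (ℕ × Word k × List (Word k)) => x.2.1 :=
    Primrec.fst.comp .snd
  have hu : Primrec fun x : Word k × (ℕ × Word k × List (Word k)) => x.2.2.1 :=
    Primrec.fst.comp (Primrec.snd.comp .snd)
  have hl : Primrec fun x : Word k × (ℕ × Word k × List (Word k)) => x.2.2.2 :=
    Primrec.snd.comp (Primrec.snd.comp .snd)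
  have hd := C.primrec_dec.comp hn hu
  have hs := Primrec.eq.comp hd (option_some.comp hl)
  refine SemiDec.ex ((C.semiDec_mode.comp hn).and (SemiDec.or (SemiDec.and (SemiDec.of_primrec
    (PrimrecPred.and (Primrec.eq.comp .fst (primrec_tuple₂ hu (.const _))) hs))
    (C.semiDec_allDom.comp (Primrec.pair hn hl))) (SemiDec.and (SemiDec.of_primrec
    (Primrec.eq.comp .fst (primrec_tuple₂ hu (.const _)))) (SemiDec.or (SemiDec.of_primrec
    (Primrec.eq.comp hd (.const none))) (SemiDec.and (SemiDec.of_primrec hs)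
    (C.semiDec_someNotDom.comp (Primrec.pair hn hl)))))))

/-- Format and base words, paired with their decodings. -/
abbrev CapData (k : ℕ) : Type :=
  ℕ × (Word k × List (Word k)) × (Word k × List (Word k)) × (Word k × List (Word k))

/-- In the direction `i`, the third list refines the intersection of the first two. -/
def CapAt (p : Seq k) (y : CapData k) (i : ℕ) : Prop :=
  (i < y.2.1.2.length ∧ i < y.2.2.1.2.length) ∧
    InSeq (tuple [y.2.1.2.getD i [], y.2.2.1.2.getD i [], y.2.2.2.2.getD i []])
      (C.capSeq p (y.1, i)) ∨
  (y.2.1.2.length ≤ i ∧ y.2.2.2.2.getD i [] = y.2.2.1.2.getD i []) ∧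
    InSeq (tuple [y.2.2.2.2.getD i [], [1]]) (C.domSeq p (y.1, i)) ∨
  (y.2.2.1.2.length ≤ i ∧ y.2.2.2.2.getD i [] = y.2.1.2.getD i []) ∧
    InSeq (tuple [y.2.2.2.2.getD i [], [1]]) (C.domSeq p (y.1, i))

/-- The words confirmed to code triples of the intersection relation. -/
def CapPred (p : Seq k) (w : Word k) : Prop :=
  ∃ y : CapData k, C.mode p y.1 ∧
    (w = tuple [y.2.1.1, y.2.2.1.1, y.2.2.2.1] ∧ C.dec y.1 y.2.1.1 = some y.2.1.2 ∧
      C.dec y.1 y.2.2.1.1 = some y.2.2.1.2 ∧ C.dec y.1 y.2.2.2.1 = some y.2.2.2.2 ∧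
      y.2.2.2.2.length = max y.2.1.2.length y.2.2.1.2.length) ∧
    ∀ i ∈ List.range y.2.2.2.2.length, C.CapAt p y i

theorem semiDec_capAt : SemiDec fun p (x : CapData k × ℕ) => C.CapAt p x.1 x.2 := by
  have ha : Primrec fun x : CapData k × ℕ => (x.1.1, x.2) :=
    Primrec.pair (Primrec.fst.comp .fst) .snd
  have h1 : Primrec fun x : CapData k × ℕ => x.1.2.1.2 :=
    Primrec.snd.comp (Primrec.fst.comp (Primrec.snd.comp .fst))
  have h2 : Primrec fun x : CapData k × ℕ => x.1.2.2.1.2 :=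
    Primrec.snd.comp (Primrec.fst.comp (Primrec.snd.comp (Primrec.snd.comp .fst)))
  have h3 : Primrec fun x : CapData k × ℕ => x.1.2.2.2.2 :=
    Primrec.snd.comp (Primrec.snd.comp (Primrec.snd.comp (Primrec.snd.comp .fst)))
  have g1 := (list_getD ([] : Word k)).comp h1 .snd
  have g2 := (list_getD ([] : Word k)).comp h2 .snd
  have g3 := (list_getD ([] : Word k)).comp h3 .snd
  have hdom := C.semiDec_domSeq ha (primrec_tuple₂ g3 (.const [1]))
  have hcap := C.semiDec_capSeq ha (primrec_tuple₃ g1 g2 g3)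
  exact SemiDec.or (SemiDec.and (SemiDec.of_primrec (PrimrecPred.and
    (nat_lt.comp .snd (list_length.comp h1)) (nat_lt.comp .snd (list_length.comp h2)))) hcap)
    (SemiDec.or (SemiDec.and (SemiDec.of_primrec (PrimrecPred.and
      (nat_le.comp (list_length.comp h1) .snd) (Primrec.eq.comp g3 g2))) hdom)
    (SemiDec.and (SemiDec.of_primrec (PrimrecPred.and
      (nat_le.comp (list_length.comp h2) .snd) (Primrec.eq.comp g3 g1))) hdom))

theorem semiDec_capPred : SemiDec C.CapPred := by
  have hn : Primrec fun x : Word k × CapData k => x.2.1 := Primrec.fst.comp .snd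
  have h1 : Primrec fun x : Word k × CapData k => x.2.2.1 :=
    Primrec.fst.comp (Primrec.snd.comp .snd)
  have h2 : Primrec fun x : Word k × CapData k => x.2.2.2.1 :=
    Primrec.fst.comp (Primrec.snd.comp (Primrec.snd.comp .snd))
  have h3 : Primrec fun x : Word k × CapData k => x.2.2.2.2 :=
    Primrec.snd.comp (Primrec.snd.comp (Primrec.snd.comp .snd))
  have hd : ∀ {g : Word k × CapData k → Word k × List (Word k)}, Primrec g →
      PrimrecPred fun x => C.dec x.2.1 (g x).1 = some (g x).2 := fun hg =>
    Primrec.eq.comp (C.primrec_dec.comp hn (Primrec.fst.comp hg))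
      (option_some.comp (Primrec.snd.comp hg))
  refine SemiDec.ex ((C.semiDec_mode.comp hn).and (SemiDec.and (SemiDec.of_primrec
    (PrimrecPred.and (Primrec.eq.comp .fst (primrec_tuple₃ (Primrec.fst.comp h1)
      (Primrec.fst.comp h2) (Primrec.fst.comp h3)))
    (PrimrecPred.and (hd h1) (PrimrecPred.and (hd h2) (PrimrecPred.and (hd h3)
      (Primrec.eq.comp (list_length.comp (Primrec.snd.comp h3))
        (nat_max.comp (list_length.comp (Primrec.snd.comp h1))
          (list_length.comp (Primrec.snd.comp h2))))))))) ?_))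
  exact SemiDec.all (F := fun x : Word k × CapData k => List.range x.2.2.2.2.2.length)
    (list_range.comp (list_length.comp (Primrec.snd.comp h3)))
    (C.semiDec_capAt.comp (Primrec.pair (Primrec.snd.comp .fst) .snd))

/-- For every choice of one side from each box, the sides chosen in some direction are listed as a
cover. -/
def AllChoices (p : Seq k) (y : ℕ × List (List (Word k))) : Prop :=
  ∀ c ∈ (y.2.map indexed).sections,
    ∃ i, C.idx y.1 i ∧ InSeq (tuple (select c i)) (C.coverSeq p (y.1, i))

/-- The choices form a computable finite list, while the direction is searched for among all
indices. A direction without chosen sides also counts: its set may be empty, and then the empty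
cover `tuple []` is listed. -/
theorem semiDec_allChoices : SemiDec C.AllChoices := by
  have hidx : Primrec (indexed (k := k)) := list_map (list_range.comp list_length)
    (Primrec.pair .snd ((list_getD []).comp .fst .snd)).to₂
  have hsel : Primrec₂ (select (k := k)) := listFilterMap .fst
    (Primrec.ite (Primrec.eq.comp (Primrec.fst.comp .snd) (Primrec.snd.comp .fst))
      (option_some.comp (Primrec.snd.comp .snd)) (.const none)).to₂
  refine SemiDec.all (F := fun y : ℕ × List (List (Word k)) => (y.2.map indexed).sections)
    (primrec_sections.comp (list_map .snd (hidx.comp .snd).to₂))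
    (SemiDec.ex (SemiDec.and (SemiDec.of_primrec
      (C.primrec_idx.comp (Primrec.fst.comp (Primrec.fst.comp .fst)) .snd)) ?_))
  exact C.semiDec_coverSeq (Primrec.pair (Primrec.fst.comp (Primrec.fst.comp .fst)) .snd)
    (primrec_tuple.comp (hsel.comp (Primrec.snd.comp .fst) .snd))

/-- The words confirmed to code finite covers. -/
def CoverPred (p : Seq k) (w : Word k) : Prop :=
  ∃ y : ℕ × List (List (Word k)), C.mode p y.1 ∧ (parts w).map (C.dec y.1) = y.2.map some ∧
    (∀ l ∈ y.2, C.AllDom p (y.1, l)) ∧ C.AllChoices p y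

theorem semiDec_coverPred : SemiDec C.CoverPred := by
  have hn : Primrec fun x : Word k × (ℕ × List (List (Word k))) => x.2.1 := Primrec.fst.comp .snd
  have hL : Primrec fun x : Word k × (ℕ × List (List (Word k))) => x.2.2 := Primrec.snd.comp .snd
  refine SemiDec.ex ((C.semiDec_mode.comp hn).and (SemiDec.and (SemiDec.of_primrec
    (Primrec.eq.comp (list_map (primrec_parts.comp .fst)
      (C.primrec_dec.comp (hn.comp .fst) .snd).to₂) (list_map hL (option_some.comp .snd).to₂)))
    (SemiDec.and ?_ (C.semiDec_allChoices.comp .snd))))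
  exact SemiDec.all (F := fun x : Word k × (ℕ × List (List (Word k))) => x.2.2) hL
    (C.semiDec_allDom.comp (Primrec.pair (hn.comp .fst) .snd))

end Scheme

/-! ### Correctness of the confirmed predicates on names -/

theorem EffSpace.tuple_one_mem_charGraph (X : EffSpace.{u} k) {w : Word k} :
    tuple [w, [1]] ∈ X.charGraph ↔ w ∈ X.dom := by
  constructor
  · rintro ⟨v, ⟨hv, h⟩ | ⟨_, h⟩⟩ <;> have := tuple_injective h <;> simp_all
  · exact fun h => ⟨w, .inl ⟨h, rfl⟩⟩

theorem EffSpace.tuple_zero_mem_charGraph (X : EffSpace.{u} k) {w : Word k} :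
    tuple [w, [0]] ∈ X.charGraph ↔ w ∉ X.dom := by
  constructor
  · rintro ⟨v, ⟨_, h⟩ | ⟨hv, h⟩⟩ <;> have := tuple_injective h <;> simp_all
  · exact fun h => ⟨w, .inr ⟨h, rfl⟩⟩

/-- A name lists all words coding a cover, so it is enough to look for one canonical code of a given
finite family. -/
theorem EffSpace.tuple_mem_finCovers (X : EffSpace.{u} k) {K : Set X} {l : List (Word k)}
    (hl : ∀ v ∈ l, v ∈ X.dom) :
    tuple l ∈ X.finCovers K ↔ K ⊆ ⋃ v ∈ {v | v ∈ l}, X.nu v := by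
  simp only [finCovers, inWord_tuple, Set.mem_ofPred_eq]
  exact and_iff_right hl

namespace Scheme

/-- The sequence `p` has the format `n` and consists of names of the pairs `B i`. -/
structure Names (C : Scheme k) (p : Seq k) (n : ℕ) (B : ℕ → CompactPair.{u} k) : Prop where
  mode_iff : ∀ m, C.mode p m ↔ m = n
  name : ∀ i, C.idx n i → kappaDelta (fun j => p (C.pos (n, i) j)) (B i)

section

variable {C : Scheme k} {p : Seq k} {n : ℕ} {B : ℕ → CompactPair.{u} k} {Z : CompactPair.{u} k}

theorem Names.enumerates_domSeq (h : C.Names p n B) {i : ℕ} (hi : C.idx n i) :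
    Enumerates (C.domSeq p (n, i)) (B i).space.charGraph := by
  obtain ⟨r, s, hp, ⟨r', s', rfl, hr', -⟩, -⟩ := h.name i hi
  convert hr' using 1
  funext j
  rw [domSeq, congrFun hp, seqPair_even, seqPair_even]

theorem Names.enumerates_coverSeq (h : C.Names p n B) {i : ℕ} (hi : C.idx n i) :
    Enumerates (C.coverSeq p (n, i)) ((B i).space.finCovers (B i).set) := by
  obtain ⟨r, s, hp, -, hs⟩ := h.name i hi
  convert hs using 1
  funext j
  rw [coverSeq, congrFun hp, seqPair_odd]

theorem Names.exists_capSeq (h : C.Names p n B) {i : ℕ} (hi : C.idx n i) :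
    ∃ S : Set (Word k × Word k × Word k),
      (∀ a ∈ S, a.1 ∈ (B i).space.dom ∧ a.2.1 ∈ (B i).space.dom ∧ a.2.2 ∈ (B i).space.dom) ∧
      (∀ a, InSeq (tuple [a.1, a.2.1, a.2.2]) (C.capSeq p (n, i)) ↔ a ∈ S) ∧
      ∀ u ∈ (B i).space.dom, ∀ v ∈ (B i).space.dom, (B i).space.nu u ∩ (B i).space.nu v =
        ⋃ w ∈ {w | (u, v, w) ∈ S}, (B i).space.nu w := by
  obtain ⟨r, s, hp, ⟨r', s', rfl, -, S, hS, hs', hcap⟩, -⟩ := h.name i hi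
  refine ⟨S, hS, fun a => ?_, hcap⟩
  have : C.capSeq p (n, i) = s' := by
    funext j
    rw [capSeq, congrFun hp, seqPair_even, seqPair_odd]
  rw [this, hs']
  constructor
  · rintro ⟨b, hb, hba⟩
    have := tuple_injective hba
    simp only [List.cons.injEq, and_true] at this
    obtain rfl : b = a := Prod.ext this.1 (Prod.ext this.2.1 this.2.2)
    exact hb
  · exact fun ha => ⟨a, ha, rfl⟩

theorem Names.inSeq_domSeq_one (h : C.Names p n B) {i : ℕ} (hi : C.idx n i) {w : Word k} :
    InSeq (tuple [w, [1]]) (C.domSeq p (n, i)) ↔ w ∈ (B i).space.dom := by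
  rw [h.enumerates_domSeq hi, EffSpace.tuple_one_mem_charGraph]

theorem Names.inSeq_domSeq_zero (h : C.Names p n B) {i : ℕ} (hi : C.idx n i) {w : Word k} :
    InSeq (tuple [w, [0]]) (C.domSeq p (n, i)) ↔ w ∉ (B i).space.dom := by
  rw [h.enumerates_domSeq hi, EffSpace.tuple_zero_mem_charGraph]

theorem Names.allDom_iff (h : C.Names p n B) {l : List (Word k)}
    (hl : ∀ i < l.length, C.idx n i) :
    C.AllDom p (n, l) ↔ ∀ i < l.length, l.getD i [] ∈ (B i).space.dom := by
  unfold AllDom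
  refine forall_congr' fun i => ?_
  rw [List.mem_range]
  exact forall_congr' fun hi => h.inSeq_domSeq_one (hl i hi)

/-- The negative half of the characteristic graph makes a failure of membership confirmable. -/
theorem Names.someNotDom_iff (h : C.Names p n B) {l : List (Word k)}
    (hl : ∀ i < l.length, C.idx n i) :
    C.SomeNotDom p (n, l) ↔ ¬ ∀ i < l.length, l.getD i [] ∈ (B i).space.dom := by
  unfold SomeNotDom
  push Not
  refine exists_congr fun i => ?_
  constructor
  · rintro ⟨hi, h'⟩
    exact ⟨hi, (h.inSeq_domSeq_zero (hl i hi)).1 h'⟩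
  · rintro ⟨hi, h'⟩
    exact ⟨hi, (h.inSeq_domSeq_zero (hl i hi)).2 h'⟩

theorem Names.charPred_iff (h : C.Names p n B) (e : ProductCode Z B (C.idx n) (C.dec n))
    (w : Word k) : C.CharPred p w ↔ w ∈ Z.space.charGraph := by
  constructor
  · rintro ⟨⟨m, u, l⟩, hm, hw⟩
    obtain rfl := (h.mode_iff m).1 hm
    refine ⟨u, ?_⟩
    rcases hw with ⟨⟨hw, hd⟩, hl⟩ | ⟨hw, hd | ⟨hd, hl⟩⟩
    · exact .inl ⟨(e.mem_dom u).2 ⟨l, hd, (h.allDom_iff (e.index hd)).1 hl⟩, hw⟩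
    · refine .inr ⟨fun hu => ?_, hw⟩
      obtain ⟨l', hl', -⟩ := (e.mem_dom u).1 hu
      cases hd.symm.trans hl'
    · refine .inr ⟨fun hu => ?_, hw⟩
      obtain ⟨l', hl', hall⟩ := (e.mem_dom u).1 hu
      obtain rfl : l = l' := Option.some_injective _ (hd.symm.trans hl')
      exact (h.someNotDom_iff (e.index hd)).1 hl hall
  · rintro ⟨u, ⟨hu, hw⟩ | ⟨hu, hw⟩⟩
    · obtain ⟨l, hl, hall⟩ := (e.mem_dom u).1 hu
      exact ⟨(n, u, l), (h.mode_iff n).2 rfl,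
        .inl ⟨⟨hw, hl⟩, (h.allDom_iff (e.index hl)).2 hall⟩⟩
    · cases hd : C.dec n u with
      | none => exact ⟨(n, u, []), (h.mode_iff n).2 rfl, .inr ⟨hw, .inl hd⟩⟩
      | some l =>
        refine ⟨(n, u, l), (h.mode_iff n).2 rfl, .inr ⟨hw, .inr ⟨hd, ?_⟩⟩⟩
        exact (h.someNotDom_iff (e.index hd)).2 fun hall => hu ((e.mem_dom u).2 ⟨l, hd, hall⟩)

/-- The intersection relation of the product. -/
def capRel (C : Scheme k) (p : Seq k) (n : ℕ) : Set (Word k × Word k × Word k) :=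
  {a | ∃ l₁ l₂ l₃, C.dec n a.1 = some l₁ ∧ C.dec n a.2.1 = some l₂ ∧ C.dec n a.2.2 = some l₃ ∧
    l₃.length = max l₁.length l₂.length ∧
    ∀ i < l₃.length, C.CapAt p (n, (a.1, l₁), (a.2.1, l₂), (a.2.2, l₃)) i}

theorem Names.capPred_iff (h : C.Names p n B) (w : Word k) :
    C.CapPred p w ↔ w ∈ (fun a => tuple [a.1, a.2.1, a.2.2]) '' C.capRel p n := by
  constructor
  · rintro ⟨⟨m, ⟨u, l₁⟩, ⟨v, l₂⟩, ⟨x, l₃⟩⟩, hm, ⟨hw, h1, h2, h3, hlen⟩, hcap⟩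
    obtain rfl := (h.mode_iff m).1 hm
    exact ⟨(u, v, x), ⟨l₁, l₂, l₃, h1, h2, h3, hlen, fun i hi => hcap i (List.mem_range.2 hi)⟩,
      hw.symm⟩
  · rintro ⟨⟨u, v, x⟩, ⟨l₁, l₂, l₃, h1, h2, h3, hlen, hcap⟩, hw⟩
    exact ⟨(n, (u, l₁), (v, l₂), (x, l₃)), (h.mode_iff n).2 rfl, ⟨hw.symm, h1, h2, h3, hlen⟩,
      fun i hi => hcap i (List.mem_range.1 hi)⟩

/-- `Delta` requires the triples to consist of base words. Where both lists have an entry this is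
inherited from the factor's relation; a copied entry is checked in `CapAt` against the listed
domain. -/
theorem Names.capRel_subset_dom (h : C.Names p n B) (e : ProductCode Z B (C.idx n) (C.dec n)) :
    ∀ a ∈ C.capRel p n,
      a.1 ∈ Z.space.dom ∧ a.2.1 ∈ Z.space.dom ∧ a.2.2 ∈ Z.space.dom := by
  rintro ⟨u, v, x⟩ ⟨l₁, l₂, l₃, h1, h2, h3, hlen, hcap⟩
  have key : ∀ i < l₃.length, (i < l₁.length → l₁.getD i [] ∈ (B i).space.dom) ∧
      (i < l₂.length → l₂.getD i [] ∈ (B i).space.dom) ∧ l₃.getD i [] ∈ (B i).space.dom := by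
    intro i hi
    have hidx := e.index h3 i hi
    rcases hcap i hi with ⟨-, hc⟩ | ⟨⟨hle, heq⟩, hc⟩ | ⟨⟨hle, heq⟩, hc⟩
    · obtain ⟨S, hS, hs, -⟩ := h.exists_capSeq hidx
      have := hS _ ((hs (l₁.getD i [], l₂.getD i [], l₃.getD i [])).1 hc)
      exact ⟨fun _ => this.1, fun _ => this.2.1, this.2.2⟩
    · have := (h.inSeq_domSeq_one hidx).1 hc
      exact ⟨fun hlt => absurd hlt (by simpa using hle), fun _ => heq ▸ this, this⟩
    · have := (h.inSeq_domSeq_one hidx).1 hc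
      exact ⟨fun _ => heq ▸ this, fun hlt => absurd hlt (by simpa using hle), this⟩
  exact ⟨(e.mem_dom u).2 ⟨l₁, h1, fun i hi => (key i (by omega)).1 hi⟩,
    (e.mem_dom v).2 ⟨l₂, h2, fun i hi => (key i (by omega)).2.1 hi⟩,
    (e.mem_dom x).2 ⟨l₃, h3, fun i hi => (key i hi).2.2⟩⟩

theorem Names.inter_eq (h : C.Names p n B) (e : ProductCode Z B (C.idx n) (C.dec n))
    {u v : Word k} (hu : u ∈ Z.space.dom) (hv : v ∈ Z.space.dom) :
    Z.space.nu u ∩ Z.space.nu v = ⋃ w ∈ {w | (u, v, w) ∈ C.capRel p n}, Z.space.nu w := by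
  obtain ⟨l₁, h1, hd1⟩ := (e.mem_dom u).1 hu
  obtain ⟨l₂, h2, hd2⟩ := (e.mem_dom v).1 hv
  ext z
  obtain ⟨x, rfl⟩ := e.point_surjective z
  rw [Set.mem_inter_iff, e.mem_nu h1, e.mem_nu h2, Set.mem_iUnion₂]
  constructor
  · rintro ⟨hx1, hx2⟩
    have hidx : ∀ i < max l₁.length l₂.length, C.idx n i := by
      intro i hi
      rcases lt_max_iff.1 hi with hi | hi
      exacts [e.index h1 i hi, e.index h2 i hi]
    -- In each coordinate a base word around `x i` is taken: from the factor's relation if both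
    -- boxes restrict this coordinate, otherwise the entry of the only box that does.
    have key : ∀ i, ∃ w, i < max l₁.length l₂.length →
        ((i < l₁.length ∧ i < l₂.length) ∧
            InSeq (tuple [l₁.getD i [], l₂.getD i [], w]) (C.capSeq p (n, i)) ∨
          (l₁.length ≤ i ∧ w = l₂.getD i []) ∧ InSeq (tuple [w, [1]]) (C.domSeq p (n, i)) ∨
          (l₂.length ≤ i ∧ w = l₁.getD i []) ∧ InSeq (tuple [w, [1]]) (C.domSeq p (n, i))) ∧
        ∀ hi, x i hi ∈ (B i).space.nu w := by
      intro i
      by_cases hi : i < max l₁.length l₂.length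
      swap
      · exact ⟨[], fun h => absurd h hi⟩
      have hP := hidx i hi
      by_cases hi1 : i < l₁.length
      · by_cases hi2 : i < l₂.length
        · obtain ⟨S, hS, hs, hcap⟩ := h.exists_capSeq hP
          have hmem : x i hP ∈ (B i).space.nu (l₁.getD i []) ∩ (B i).space.nu (l₂.getD i []) :=
            ⟨hx1 i hi1 hP, hx2 i hi2 hP⟩
          rw [hcap _ (hd1 i hi1) _ (hd2 i hi2)] at hmem
          obtain ⟨w, hw, hxw⟩ := Set.mem_iUnion₂.1 hmem
          exact ⟨w, fun _ => ⟨.inl ⟨⟨hi1, hi2⟩, (hs (_, _, w)).2 hw⟩, fun _ => hxw⟩⟩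
        · exact ⟨l₁.getD i [], fun _ => ⟨.inr (.inr ⟨⟨by omega, rfl⟩,
            (h.inSeq_domSeq_one hP).2 (hd1 i hi1)⟩), hx1 i hi1⟩⟩
      · have hi2 : i < l₂.length := (lt_max_iff.1 hi).resolve_left hi1
        exact ⟨l₂.getD i [], fun _ => ⟨.inr (.inl ⟨⟨by omega, rfl⟩,
            (h.inSeq_domSeq_one hP).2 (hd2 i hi2)⟩), hx2 i hi2⟩⟩
    choose g hg using key
    set l₃ := (List.range (max l₁.length l₂.length)).map g with hl₃
    have hlen : l₃.length = max l₁.length l₂.length := by simp [hl₃]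
    have hget : ∀ i < l₃.length, l₃.getD i [] = g i := by
      intro i hi
      rw [List.getD_eq_getElem _ _ hi]
      simp [hl₃]
    -- The refinement is as long as the longer of the two lists, so it has a code because that list
    -- has one.
    obtain ⟨w, hw⟩ : ∃ w, C.dec n w = some l₃ := by
      rcases le_total l₁.length l₂.length with hle | hle
      · exact e.exists_code h2 (by rw [hlen, max_eq_right hle])
      · exact e.exists_code h1 (by rw [hlen, max_eq_left hle])
    refine ⟨w, ⟨l₁, l₂, l₃, h1, h2, hw, hlen, fun i hi => ?_⟩, ?_⟩
    · have := (hg i (hlen ▸ hi)).1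
      rw [← hget i hi] at this
      exact this
    · rw [e.mem_nu hw]
      intro i hi hP
      rw [hget i hi]
      exact (hg i (hlen ▸ hi)).2 hP
  · rintro ⟨w, ⟨m₁, m₂, l₃, h1', h2', h3, hlen, hcap⟩, hxw⟩
    obtain rfl : l₁ = m₁ := Option.some_injective _ (h1.symm.trans h1')
    obtain rfl : l₂ = m₂ := Option.some_injective _ (h2.symm.trans h2')
    rw [e.mem_nu h3] at hxw
    have key : ∀ i (hP : C.idx n i), i < l₃.length →
        (i < l₁.length → x i hP ∈ (B i).space.nu (l₁.getD i [])) ∧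
        (i < l₂.length → x i hP ∈ (B i).space.nu (l₂.getD i [])) := by
      intro i hP hi
      have hx := hxw i hi hP
      rcases hcap i hi with ⟨⟨hi1, hi2⟩, hc⟩ | ⟨⟨hle, heq⟩, hc⟩ | ⟨⟨hle, heq⟩, hc⟩
      · obtain ⟨S, hS, hs, hS'⟩ := h.exists_capSeq hP
        have hmem : x i hP ∈ (B i).space.nu (l₁.getD i []) ∩ (B i).space.nu (l₂.getD i []) := by
          rw [hS' _ (hd1 i hi1) _ (hd2 i hi2)]
          exact Set.mem_iUnion₂.2 ⟨_, (hs (_, _, _)).1 hc, hx⟩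
        exact ⟨fun _ => hmem.1, fun _ => hmem.2⟩
      · dsimp only at heq hle
        rw [heq] at hx
        exact ⟨fun hlt => by omega, fun _ => hx⟩
      · dsimp only at heq hle
        rw [heq] at hx
        exact ⟨fun _ => hx, fun hlt => by omega⟩
    exact ⟨fun i hi hP => (key i hP (by omega)).1 hi, fun i hi hP => (key i hP (by omega)).2 hi⟩

theorem Names.coverPred_iff (h : C.Names p n B) (e : ProductCode Z B (C.idx n) (C.dec n))
    (w : Word k) : C.CoverPred p w ↔ w ∈ Z.space.finCovers Z.set := by
  have main : ∀ L : List (List (Word k)), (parts w).map (C.dec n) = L.map some →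
      (∀ l ∈ L, ∀ i < l.length, l.getD i [] ∈ (B i).space.dom) →
      (C.AllChoices p (n, L) ↔ Z.set ⊆ ⋃ v ∈ {v | InWord v w}, Z.space.nu v) := by
    intro L hL hdom
    have hmem : ∀ l, l ∈ L ↔ ∃ v, InWord v w ∧ C.dec n v = some l := by
      intro l
      have : some l ∈ L.map some ↔ l ∈ L := by simp
      rw [← this, ← hL, List.mem_map]
      simp only [mem_parts]
    have hidx : ∀ l ∈ L, ∀ i < l.length, C.idx n i := by
      intro l hl
      obtain ⟨v, _, hv⟩ := (hmem l).1 hl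
      exact e.index hv
    have hcov := boxes_cover_iff (fun i => (B i).set) (fun i => (B i).space.nu) hidx
    have hleft : (∀ x : ∀ i, C.idx n i → (B i).space, (∀ i hi, x i hi ∈ (B i).set) →
        ∃ l ∈ L, ∀ i < l.length, ∀ hi : C.idx n i, x i hi ∈ (B i).space.nu (l.getD i [])) ↔
        Z.set ⊆ ⋃ v ∈ {v | InWord v w}, Z.space.nu v := by
      constructor
      · intro hx z hz
        obtain ⟨x, rfl⟩ := e.point_surjective z
        obtain ⟨l, hl, hxl⟩ := hx x ((e.mem_set x).1 hz)
        obtain ⟨v, hv, hvl⟩ := (hmem l).1 hl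
        exact Set.mem_iUnion₂.2 ⟨v, hv, (e.mem_nu hvl x).2 hxl⟩
      · intro hK x hx
        obtain ⟨v, hv, hxv⟩ := Set.mem_iUnion₂.1 (hK ((e.mem_set x).2 hx))
        obtain ⟨l, hl, -⟩ := (e.mem_dom v).1 (Z.space.mem_dom hxv)
        exact ⟨l, (hmem l).2 ⟨v, hv, hl⟩, (e.mem_nu hl x).1 hxv⟩
    rw [← hleft, hcov]
    refine forall_congr' fun c => forall_congr' fun hc => exists_congr fun i =>
      and_congr_right fun hi => ?_
    rw [h.enumerates_coverSeq hi, EffSpace.tuple_mem_finCovers]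
    -- The chosen sides are entries of decoded base words, hence base words of the factor.
    intro v hv
    obtain ⟨l, hl, hvl⟩ := (mem_sections_indexed hc).2 _ (mem_select.1 hv)
    obtain ⟨hi', hv'⟩ := mem_indexed.1 hvl
    dsimp only at hi' hv'
    rw [hv']
    exact hdom l hl i hi'
  constructor
  · rintro ⟨⟨m, L⟩, hm, hL, hdom, hch⟩
    obtain rfl := (h.mode_iff m).1 hm
    have hex : ∀ v, InWord v w → ∃ l ∈ L, C.dec m v = some l := by
      intro v hv
      have : C.dec m v ∈ L.map some := by
        rw [← hL]; exact List.mem_map_of_mem (mem_parts.2 hv)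
      obtain ⟨l, hl, hlv⟩ := List.mem_map.1 this
      exact ⟨l, hl, hlv.symm⟩
    have hdom' : ∀ l ∈ L, ∀ i < l.length, l.getD i [] ∈ (B i).space.dom := by
      intro l hl
      have : some l ∈ (parts w).map (C.dec m) := by rw [hL]; exact List.mem_map_of_mem hl
      obtain ⟨v, _, hv⟩ := List.mem_map.1 this
      exact (h.allDom_iff (e.index hv)).1 (hdom l hl)
    refine ⟨fun v hv => ?_, (main L hL hdom').1 hch⟩
    obtain ⟨l, hl, hlv⟩ := hex v hv
    exact (e.mem_dom v).2 ⟨l, hlv, hdom' l hl⟩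
  · rintro ⟨hdom, hK⟩
    -- All parts of `w` are base words and therefore decode, so the default `[]` does not occur.
    have hL : (parts w).map (C.dec n) = ((parts w).map fun v => (C.dec n v).getD []).map some := by
      rw [List.map_map]
      refine List.map_congr_left fun v hv => ?_
      obtain ⟨l, hl, -⟩ := (e.mem_dom v).1 (hdom v (mem_parts.1 hv))
      simp [hl]
    have hall : ∀ l ∈ (parts w).map fun v => (C.dec n v).getD [], (∀ i < l.length, C.idx n i) ∧
        ∀ i < l.length, l.getD i [] ∈ (B i).space.dom := by
      intro l hl
      obtain ⟨v, hv, rfl⟩ := List.mem_map.1 hl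
      obtain ⟨l, hl, hd⟩ := (e.mem_dom v).1 (hdom v (mem_parts.1 hv))
      rw [hl]
      exact ⟨e.index hl, hd⟩
    exact ⟨(n, _), (h.mode_iff n).2 rfl, hL,
      fun l hl => (h.allDom_iff (hall l hl).1).2 (hall l hl).2,
      (main _ hL fun l hl => (hall l hl).2).2 hK⟩

end

/-- If all names of the arguments of `f` can be read by a scheme as names of factors of which the
value is the product, then `f` is computable. -/
theorem repComputable (C : Scheme k) {M : Type v} {γ : MultiRep k M} {f : M → CompactPair.{u} k}
    (H : ∀ p x, γ p x → ∃ n B, C.Names p n B ∧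
      Nonempty (ProductCode (f x) B (C.idx n) (C.dec n))) :
    RepComputable γ kappaDelta f := by
  obtain ⟨F₁, hF₁, h₁⟩ := C.semiDec_charPred.exists_enumeration
  obtain ⟨F₂, hF₂, h₂⟩ := C.semiDec_capPred.exists_enumeration
  obtain ⟨F₃, hF₃, h₃⟩ := C.semiDec_coverPred.exists_enumeration
  refine ⟨_, ((hF₁.seqPair hF₂).seqPair hF₃).computableSeqFun, fun p x hpx => ?_⟩
  obtain ⟨n, B, h, ⟨e⟩⟩ := H p x hpx
  refine ⟨_, Part.mem_some _, _, _, rfl, ⟨_, _, rfl, ?_, C.capRel p n, h.capRel_subset_dom e, ?_,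
    fun u hu v hv => h.inter_eq e hu hv⟩, ?_⟩
  · exact fun w => (h₁ p w).trans (h.charPred_iff e w)
  · exact fun w => (h₂ p w).trans (h.capPred_iff w)
  · exact fun w => (h₃ p w).trans (h.coverPred_iff e w)

end Scheme

/-! ### Finite products -/

/-- Splits off the last component of a pair. -/
def peel (y : Word k × List (Word k)) : Option (Word k × List (Word k)) :=
  (untuple y.1).bind fun l =>
    if l.length = 2 then some (l.getD 0 [], l.getD 1 [] :: y.2) else none

/-- Decodes `⟨…⟨⟨u₀,u₁⟩,u₂⟩…,uₙ⟩`. -/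
def unnest (n : ℕ) (w : Word k) : Option (List (Word k)) :=
  ((fun o => o.bind peel)^[n] (some (w, []))).map fun y => y.1 :: y.2

theorem peel_tuple (a b : Word k) (l : List (Word k)) :
    peel (tuple [a, b], l) = some (a, b :: l) := by
  simp [peel]

theorem exists_of_peel_eq_some {y z : Word k × List (Word k)} (h : peel y = some z) :
    ∃ a b, y.1 = tuple [a, b] ∧ z = (a, b :: y.2) := by
  obtain ⟨l, hl, hz⟩ := Option.bind_eq_some_iff.1 h
  split_ifs at hz with h2
  obtain ⟨a, b, rfl⟩ := List.length_eq_two.1 h2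
  exact ⟨a, b, untuple_eq_some.1 hl, by simpa using hz.symm⟩

/-- Peeling only prepends to the accumulator and never inspects it. This reconciles the iteration,
which removes the last component first, with induction on the number of factors. -/
theorem iterate_peel (n : ℕ) (o : Option (Word k × List (Word k))) (l : List (Word k)) :
    (fun o => o.bind peel)^[n] (o.map fun y => (y.1, y.2 ++ l)) =
      ((fun o => o.bind peel)^[n] o).map fun y => (y.1, y.2 ++ l) := by
  induction n generalizing o with
  | zero => rfl
  | succ n ih =>
    rw [Function.iterate_succ_apply, Function.iterate_succ_apply, ← ih]
    congr 1
    cases o with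
    | none => rfl
    | some y =>
      simp only [Option.map_some, Option.bind_some, peel]
      cases untuple y.1 with
      | none => rfl
      | some m => by_cases hm : m.length = 2 <;> simp [hm]

theorem unnest_zero (w : Word k) : unnest 0 w = some [w] := rfl

theorem unnest_succ_tuple (n : ℕ) (a b : Word k) :
    unnest (n + 1) (tuple [a, b]) = (unnest n a).map (· ++ [b]) := by
  have := iterate_peel n (some (a, [])) [b]
  simp only [Option.map_some, List.nil_append] at this
  rw [unnest, Function.iterate_succ_apply, Option.bind_some, peel_tuple, this, unnest]
  simp [Option.map_map, Function.comp_def]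

theorem iterate_bind_none (n : ℕ) :
    (fun o => o.bind (peel (k := k)))^[n] none = none := by
  induction n with
  | zero => rfl
  | succ n ih => rw [Function.iterate_succ_apply]; exact ih

theorem unnest_succ_eq_some {n : ℕ} {w : Word k} {l : List (Word k)} :
    unnest (n + 1) w = some l ↔
      ∃ a b m, w = tuple [a, b] ∧ unnest n a = some m ∧ l = m ++ [b] := by
  constructor
  · intro h
    have : ∃ a b, w = tuple [a, b] := by
      cases hp : peel (w, ([] : List (Word k))) with
      | none =>
        rw [unnest, Function.iterate_succ_apply, Option.bind_some, hp, iterate_bind_none] at h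
        cases h
      | some z =>
        obtain ⟨a, b, hw, -⟩ := exists_of_peel_eq_some hp
        exact ⟨a, b, hw⟩
    obtain ⟨a, b, rfl⟩ := this
    rw [unnest_succ_tuple] at h
    obtain ⟨m, hm, rfl⟩ := Option.map_eq_some_iff.1 h
    exact ⟨a, b, m, rfl, hm, rfl⟩
  · rintro ⟨a, b, m, rfl, hm, rfl⟩
    rw [unnest_succ_tuple, hm]; rfl

theorem length_of_unnest {n : ℕ} {w : Word k} {l : List (Word k)} (h : unnest n w = some l) :
    l.length = n + 1 := by
  induction n generalizing w l with
  | zero => cases h; rfl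
  | succ n ih =>
    obtain ⟨a, b, m, -, hm, rfl⟩ := unnest_succ_eq_some.1 h
    rw [List.length_append, ih hm]; rfl

theorem exists_unnest {n : ℕ} {l : List (Word k)} (h : l.length = n + 1) :
    ∃ w, unnest n w = some l := by
  induction n generalizing l with
  | zero =>
    obtain ⟨a, rfl⟩ := List.length_eq_one_iff.1 h
    exact ⟨a, rfl⟩
  | succ n ih =>
    have hne : l ≠ [] := by rintro rfl; simp at h
    obtain ⟨a, ha⟩ := ih (l := l.dropLast) (by simp [h])
    refine ⟨tuple [a, l.getLast hne], unnest_succ_eq_some.2 ⟨a, _, _, rfl, ha, ?_⟩⟩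
    rw [List.dropLast_append_getLast]

theorem primrec_unnest : Primrec₂ (unnest (k := k)) := by
  have hpeel : Primrec (peel (k := k)) := by
    refine option_bind (primrec_untuple.comp .fst) (Primrec.ite (Primrec.eq.comp
      (list_length.comp .snd) (.const 2)) (option_some.comp (Primrec.pair
      ((list_getD []).comp .snd (.const 0)) (list_cons.comp ((list_getD []).comp .snd (.const 1))
      (Primrec.snd.comp .fst)))) (.const none)).to₂
  refine option_map (nat_iterate .fst (option_some.comp (Primrec.pair .snd (.const [])))
    ((option_bind₁ hpeel).comp .snd).to₂) (list_cons.comp (Primrec.fst.comp .snd)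
      (Primrec.snd.comp .snd)).to₂

/-- The point of a finite product with given coordinates. -/
def finPoint (B : ℕ → CompactPair.{u} k) : (n : ℕ) → (∀ i, i ≤ n → (B i).space) →
    (CompactPair.finProd n fun i => B i).space
  | 0, x => x 0 le_rfl
  | n + 1, x => (finPoint B n fun i hi => x i (hi.trans (Nat.le_succ n)), x (n + 1) le_rfl)

theorem finPoint_surjective (B : ℕ → CompactPair.{u} k) (n : ℕ) :
    Function.Surjective (finPoint B n) := by
  induction n with
  | zero =>
    intro z
    refine ⟨fun i hi => (Nat.le_zero.1 hi).symm ▸ z, rfl⟩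
  | succ n ih =>
    rintro ⟨z, y⟩
    obtain ⟨x, rfl⟩ := ih z
    -- An index that is at most `n + 1` but not at most `n` equals `n + 1`, so the last coordinate
    -- is transported along this equality.
    refine ⟨fun i hi => if h : i ≤ n then x i h
      else (show n + 1 = i by omega) ▸ (y : (B (n + 1)).space), ?_⟩
    refine Prod.ext ?_ ?_
    · change finPoint B n _ = _
      congr 1
      funext i hi
      exact dif_pos hi
    · change dite _ _ _ = _
      rw [dif_neg (by omega)]

theorem forall_lt_length_append {l : List (Word k)} {b : Word k} {n : ℕ} (hl : l.length = n + 1)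
    {Q : ℕ → Word k → Prop} :
    (∀ i < (l ++ [b]).length, Q i ((l ++ [b]).getD i [])) ↔
      (∀ i < l.length, Q i (l.getD i [])) ∧ Q (n + 1) b := by
  have h1 : ∀ i < l.length, (l ++ [b]).getD i [] = l.getD i [] := fun i hi =>
    List.getD_append _ _ _ _ hi
  have h2 : (l ++ [b]).getD (n + 1) [] = b := by
    rw [List.getD_append_right _ _ _ _ hl.le, hl]; simp
  constructor
  · intro h
    refine ⟨fun i hi => ?_, ?_⟩
    · rw [← h1 i hi]; exact h i (by rw [List.length_append]; omega)
    · have := h (n + 1) (by rw [List.length_append, hl]; simp)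
      rwa [h2] at this
  · rintro ⟨h, h'⟩ i hi
    rw [List.length_append, List.length_singleton] at hi
    rcases Nat.lt_or_ge i l.length with hlt | hge
    · rw [h1 i hlt]; exact h i hlt
    · obtain rfl : i = n + 1 := by omega
      rw [h2]; exact h'

theorem mem_dom_finProd (B : ℕ → CompactPair.{u} k) (n : ℕ) (w : Word k) :
    w ∈ (CompactPair.finProd n fun i => B i).space.dom ↔
      ∃ l, unnest n w = some l ∧ ∀ i < l.length, l.getD i [] ∈ (B i).space.dom := by
  induction n generalizing w with
  | zero =>
    simp only [unnest_zero, Option.some.injEq, exists_eq_left', List.length_singleton,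
      Nat.lt_one_iff, forall_eq]
    rfl
  | succ n ih =>
    constructor
    · rintro ⟨a, ha, b, hb, rfl⟩
      obtain ⟨l, hl, hd⟩ := (ih a).1 ha
      exact ⟨l ++ [b], unnest_succ_eq_some.2 ⟨a, b, l, rfl, hl, rfl⟩,
        (forall_lt_length_append (length_of_unnest hl)
          (Q := fun i v => v ∈ (B i).space.dom)).2 ⟨hd, hb⟩⟩
    · rintro ⟨_, h, hd⟩
      obtain ⟨a, b, l, rfl, hl, rfl⟩ := unnest_succ_eq_some.1 h
      obtain ⟨hd, hb⟩ := (forall_lt_length_append (length_of_unnest hl)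
          (Q := fun i v => v ∈ (B i).space.dom)).1 hd
      exact ⟨a, (ih a).2 ⟨l, hl, hd⟩, b, hb, rfl⟩

theorem finPoint_mem_nu (B : ℕ → CompactPair.{u} k) (n : ℕ) {w : Word k} {l : List (Word k)}
    (h : unnest n w = some l) (x : ∀ i, i ≤ n → (B i).space) :
    finPoint B n x ∈ (CompactPair.finProd n fun i => B i).space.nu w ↔
      ∀ i < l.length, ∀ hi : i ≤ n, x i hi ∈ (B i).space.nu (l.getD i []) := by
  induction n generalizing w l with
  | zero =>
    cases h
    constructor
    · intro h i hi h0
      obtain rfl := Nat.le_zero.1 h0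
      exact h
    · intro h
      exact h 0 (by simp) le_rfl
  | succ n ih =>
    obtain ⟨a, b, l, rfl, hl, rfl⟩ := unnest_succ_eq_some.1 h
    have hnu : (CompactPair.finProd (n + 1) fun i => B i).space.nu (tuple [a, b]) =
        (CompactPair.finProd n fun i => B i).space.nu a ×ˢ (B (n + 1)).space.nu b :=
      EffSpace.prodNu_tuple _ _ a b
    have hlen := length_of_unnest hl
    rw [hnu, forall_lt_length_append hlen
      (Q := fun i v => ∀ hi : i ≤ n + 1, x i hi ∈ (B i).space.nu v)]
    refine and_congr ((ih hl _).trans ?_) ⟨fun h _ => h, fun h => h le_rfl⟩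
    exact forall_congr' fun i => forall_congr' fun hi =>
      ⟨fun h _ => h (by omega), fun h _ => h _⟩

theorem finPoint_mem_set (B : ℕ → CompactPair.{u} k) (n : ℕ) (x : ∀ i, i ≤ n → (B i).space) :
    finPoint B n x ∈ (CompactPair.finProd n fun i => B i).set ↔
      ∀ i (hi : i ≤ n), x i hi ∈ (B i).set := by
  induction n with
  | zero =>
    constructor
    · intro h i h0
      obtain rfl := Nat.le_zero.1 h0
      exact h
    · intro h
      exact h 0 le_rfl
  | succ n ih =>
    constructor
    · rintro ⟨h1, h2⟩ i hi
      rcases Nat.lt_or_ge n i with hlt | hle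
      · obtain rfl : i = n + 1 := by omega
        exact h2
      · exact (ih _).1 h1 i hle
    · intro h
      exact ⟨(ih _).2 fun i hi => h i _, h (n + 1) le_rfl⟩

/-- Finite products in coordinates. -/
def finProductCode (B : ℕ → CompactPair.{u} k) (n : ℕ) :
    ProductCode (CompactPair.finProd n fun i => B i) B (· ≤ n) (unnest n) where
  point := finPoint B n
  point_surjective := finPoint_surjective B n
  index h i hi := by rw [length_of_unnest h] at hi; omega
  exists_code h h' := exists_unnest (h'.trans (length_of_unnest h))
  mem_dom := mem_dom_finProd B n
  mem_nu := finPoint_mem_nu B n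
  mem_set := finPoint_mem_set B n

/-! ### Countable products -/

/-- Decodes tuples of positive length. -/
def untuplePos (w : Word k) : Option (List (Word k)) :=
  (untuple w).bind fun l => if l = [] then none else some l

theorem untuplePos_eq_some {w : Word k} {l : List (Word k)} :
    untuplePos w = some l ↔ l ≠ [] ∧ w = tuple l := by
  constructor
  · intro h
    obtain ⟨m, hm, hl⟩ := Option.bind_eq_some_iff.1 h
    split_ifs at hl with h0
    cases hl
    exact ⟨h0, untuple_eq_some.1 hm⟩
  · rintro ⟨h0, rfl⟩
    simp [untuplePos, h0]

theorem primrec_untuplePos : Primrec (untuplePos (k := k)) :=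
  option_bind primrec_untuple (Primrec.ite (Primrec.eq.comp .snd (.const []))
    (.const none) (option_some.comp .snd)).to₂

/-- Countable products in coordinates. -/
def piProductCode (B : ℕ → CompactPair.{u} k) :
    ProductCode (CompactPair.pi B) B (fun _ => True) untuplePos where
  point x := fun i => x i trivial
  point_surjective z := ⟨fun i _ => z i, rfl⟩
  index _ _ _ := trivial
  exists_code {w l l'} h h' := by
    refine ⟨tuple l', untuplePos_eq_some.2 ⟨?_, rfl⟩⟩
    rintro rfl
    exact (untuplePos_eq_some.1 h).1 (List.length_eq_zero_iff.1 h'.symm)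
  mem_dom w := by
    refine exists_congr fun l => ?_
    rw [untuplePos_eq_some, and_assoc]
    refine and_congr_right fun _ => and_congr_right fun _ => forall_congr' fun i =>
      forall_congr' fun hi => ?_
    rw [List.getD_eq_getElem _ _ hi]
  mem_nu {w l} h x := by
    obtain ⟨h0, rfl⟩ := untuplePos_eq_some.1 h
    change _ ∈ EffSpace.piNu _ (tuple l) ↔ _
    rw [EffSpace.piNu_tuple _ h0]
    refine forall_congr' fun i => forall_congr' fun hi => ?_
    rw [List.getD_eq_getElem _ _ hi]
    exact ⟨fun h _ => h, fun h => h trivial⟩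
  mem_set x := ⟨fun h i _ => h i trivial, fun h i _ => h i trivial⟩

/-! ### Reading the names of pairs, tuples and sequences -/

/-- Names of pairs. -/
def pairScheme (k : ℕ) : Scheme k where
  mode _ n := n = 1
  pos a j := 2 * j + a.2
  idx n i := i ≤ n
  dec := unnest
  semiDec_mode := SemiDec.of_primrec (Primrec.eq.comp .id (.const 1))
  primrec_pos := nat_add.comp (nat_double.comp .snd) (Primrec.snd.comp .fst)
  primrec_idx := nat_le.comp .snd .fst
  primrec_dec := primrec_unnest

/-- Names of tuples; in the format `n` the tuple has length `n + 1`. -/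
def plusScheme (k : ℕ) : Scheme k where
  mode p n := (∀ i ∈ List.range (n + 1), some 1 = some (p i)) ∧ some 0 = some (p (n + 1))
  -- The tag, `n + 1` ones and a zero, occupies the first `n + 2` positions.
  pos a j := (a.1 + 2) + (j * (a.1 + 1) + a.2)
  idx n i := i ≤ n
  dec := unnest
  semiDec_mode := SemiDec.and (SemiDec.all (F := fun n => List.range (n + 1))
    (list_range.comp .succ) (SemiDec.symbol .snd (.const _)))
    (SemiDec.symbol .succ (.const _))
  primrec_pos := by
    have hn : Primrec fun x : (ℕ × ℕ) × ℕ => x.1.1 := Primrec.fst.comp .fst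
    exact nat_add.comp (nat_add.comp hn (.const 2)) (nat_add.comp (nat_mul.comp .snd
      (Primrec.succ.comp hn)) (Primrec.snd.comp .fst))
  primrec_idx := nat_le.comp .snd .fst
  primrec_dec := primrec_unnest

/-- Names of sequences. -/
def seqScheme (k : ℕ) : Scheme k where
  mode _ n := n = 0
  pos a j := cantorPair a.2 j
  idx _ _ := True
  dec _ := untuplePos
  semiDec_mode := SemiDec.of_primrec (Primrec.eq.comp .id (.const 0))
  primrec_pos := by
    have hs : Primrec fun x : (ℕ × ℕ) × ℕ => x.1.2 + x.2 :=
      nat_add.comp (Primrec.snd.comp .fst) .snd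
    exact nat_add.comp (nat_div.comp (nat_mul.comp hs (Primrec.succ.comp hs)) (.const 2)) .snd
  primrec_idx := (Primrec.eq.comp (.const 0) (.const 0)).of_eq fun _ => by simp
  primrec_dec := primrec_untuplePos.comp .snd

theorem seqTuple_apply {n : ℕ} (p : Fin (n + 1) → Seq k) (i : Fin (n + 1)) (j : ℕ) :
    seqTuple p (j * (n + 1) + i) = p i j := by
  have h1 : Fin.ofNat (n + 1) (j * (n + 1) + i) = i := by
    apply Fin.ext
    simp [Fin.ofNat, Nat.mod_eq_of_lt i.2]
  have h2 : (j * (n + 1) + i) / (n + 1) = j := by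
    rw [Nat.add_comm, Nat.add_mul_div_right _ _ (Nat.succ_pos n), Nat.div_eq_of_lt i.2, zero_add]
  rw [seqTuple, h1, h2]

/-- The first `0` ends the tag, so the format can be read off unambiguously. -/
theorem plusScheme_mode_tag (n m : ℕ) (p : Seq k) :
    (plusScheme k).mode (tag (n + 1) p) m ↔ m = n := by
  simp only [plusScheme, tag, List.mem_range, Option.some.injEq]
  constructor
  · rintro ⟨h1, h2⟩
    by_contra hne
    rcases Nat.lt_or_gt_of_ne hne with h | h
    · rw [if_pos (by omega)] at h2
      simp at h2
    · have := h1 (n + 1) (by omega)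
      simp at this
  · rintro rfl
    exact ⟨fun i hi => by rw [if_pos hi], by simp⟩

/-! ### The three product maps -/

theorem repComputable_prod (k : ℕ) :
    RepComputable (kappaDelta.pair kappaDelta) kappaDelta
      (fun A : CompactPair.{u} k × CompactPair.{u} k => A.1.prod A.2) := by
  refine (pairScheme k).repComputable fun p A hp => ?_
  obtain ⟨p₁, p₂, rfl, h₁, h₂⟩ := hp
  -- Format `1` means two factors; the values of the family beyond index `1` play no role.
  refine ⟨1, fun i => if i = 0 then A.1 else A.2, ⟨fun m => Iff.rfl, fun i hi => ?_⟩,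
    ⟨finProductCode (fun i => if i = 0 then A.1 else A.2) 1⟩⟩
  have hi : i ≤ 1 := hi
  interval_cases i
  · change kappaDelta _ A.1
    convert h₁ using 1
    funext j
    exact seqPair_even p₁ p₂ j
  · change kappaDelta _ A.2
    convert h₂ using 1
    funext j
    exact seqPair_odd p₁ p₂ j

theorem repComputable_finProd (k : ℕ) :
    RepComputable kappaDelta.plus kappaDelta
      (fun A : Σ n : ℕ, (Fin (n + 1) → CompactPair.{u} k) => CompactPair.finProd A.1 A.2) := by
  refine (plusScheme k).repComputable fun p A hp => ?_
  obtain ⟨n, A⟩ := A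
  obtain ⟨q, rfl, hq⟩ := hp
  -- The family is extended to all indices by reduction modulo `n + 1`, which changes nothing up to
  -- `n`.
  have hA : ∀ i : Fin (n + 1), A (Fin.ofNat (n + 1) i) = A i := fun i => by
    rw [Fin.ofNat_val_eq_self]
  refine ⟨n, fun i => A (Fin.ofNat (n + 1) i), ⟨fun m => plusScheme_mode_tag n m _,
    fun i hi => ?_⟩, ⟨?_⟩⟩
  · have hi : i ≤ n := hi
    have hlt : i < n + 1 := by omega
    have hi' : A (Fin.ofNat (n + 1) i) = A ⟨i, hlt⟩ := hA ⟨i, hlt⟩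
    rw [hi']
    convert hq ⟨i, hlt⟩ using 1
    funext j
    change tag (n + 1) (seqTuple q) ((n + 2) + (j * (n + 1) + i)) = _
    rw [tag, if_neg (by omega), if_neg (by omega), ← seqTuple_apply q ⟨i, hlt⟩ j]
    congr 1
    dsimp only
    omega
  · have := finProductCode (fun i => A (Fin.ofNat (n + 1) i)) n
    simp only [hA] at this
    exact this

theorem repComputable_pi (k : ℕ) :
    RepComputable kappaDelta.seq kappaDelta
      (fun A : ℕ → CompactPair.{u} k => CompactPair.pi A) := by
  refine (seqScheme k).repComputable fun p A hp => ?_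
  obtain ⟨q, hpq, hq⟩ := hp
  refine ⟨0, A, ⟨fun m => Iff.rfl, fun i _ => ?_⟩, ⟨piProductCode A⟩⟩
  convert hq i using 1
  funext j
  exact hpq i j

end TTE

theorem theorem6 (k : ℕ) :
    TTE.RepComputable (TTE.kappaDelta.pair TTE.kappaDelta) TTE.kappaDelta
      (fun A : TTE.CompactPair.{u} k × TTE.CompactPair.{u} k => A.1.prod A.2) ∧
    TTE.RepComputable TTE.kappaDelta.plus TTE.kappaDelta
      (fun A : Σ n : ℕ, (Fin (n + 1) → TTE.CompactPair.{u} k) =>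
        TTE.CompactPair.finProd A.1 A.2) ∧
    TTE.RepComputable TTE.kappaDelta.seq TTE.kappaDelta
      (fun A : ℕ → TTE.CompactPair.{u} k => TTE.CompactPair.pi A) := by
  exact ⟨TTE.repComputable_prod k, TTE.repComputable_finProd k, TTE.repComputable_pi k⟩
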